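/- Let $X\subseteq\mathbb R^m$, $Y\subseteq\mathbb R^n$ be convex compact sets, each with at least two points, with diameters $D_X,D_Y$, and let $f(x,y)$ be differentiable at every point of $X\times Y$, $L$-smooth on $X\times Y$ (i.e. $\|\nabla f(x_1,y_1)-\nabla f(x_2,y_2)\|^2\le L^2(\|x_1-x_2\|^2+\|y_1-y_2\|^2)$), convex in $x$ for every $y\in Y$ and $\mu$-strongly concave in $y$ for every $x\in X$, where $L,\mu>0$; put $\kappa=L/\mu$. A first-order oracle (FO) call returns $\nabla f$ at a point of $X\times Y$; a linear-optimization oracle (LO) call returns, for a vector $g$, a minimizer of $\langle v,g\rangle$ over $v\in X$ or over $v\in Y$. *CndG.* For $r$, $q\in\Omega$, $\beta$, $\eta$, the procedure $\mathrm{CndG}(r,q,\beta,\eta,\Omega)$ starts from $q_1=q$. For $t=1,2,\dots$ it puts $g_t=r+\beta(q_t-q)$, obtains $p_t\in\arg\min_{v\in\Omega}\langle v,g_t\rangle$ by one LO call, and puts $\tau_t=\langle g_t,q_t-p_t\rangle$; it returns $q_t$ if $\tau_t\le\eta$, and otherwise sets $q_{t+1}=(1-\theta_t)q_t+\theta_tp_t$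 with $\theta_t=\min\{1,\tau_t/(\beta\|q_t-p_t\|^2)\}$. *CGS.* For a function $h$ on $\Omega$, a starting point $\bar x_0\in\Omega$, a number $\delta\ge h(\bar x_0)-\min_\Omega h$ and a number $T$ of outer iterations, conditional gradient sliding (CGS) performs for $t=1,\dots,T$ the following: $x_0=u_0=\bar x_{t-1}$; for $k=1,\dots,M:=\lceil\sqrt{24L/\mu}\,\rceil$, $w_k=(1-\lambda_k)x_{k-1}+\lambda_ku_{k-1}$, $u_k=\mathrm{CndG}(\nabla h(w_k),u_{k-1},\beta_k,\eta_{t,k},\Omega)$, $x_k=(1-\lambda_k)x_{k-1}+\lambda_ku_k$, with $\lambda_k=\frac2{k+1}$, $\beta_k=\frac{2L}k$, $\eta_{t,k}=\frac{8L\delta2^{-t}}{\mu Tk}$; then $\bar x_t=x_M$. Its output is $\bar x_T$. *MPCGS.* Given $x_0\in X$, $y_0\in Y$ and $v_0=x_0$, Mirror-Prox Conditional Gradient Sliding with $N$ iterations performs for $k=1,\dots,N$ the following. Put $\gamma_k=\frac3{k+2}$, $\alpha_k=\frac{6\kappa L}{k+1}$, $\zeta_k=\frac{LD_X^2}{384k(k+1)}$,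 $\epsilon_k=\frac{\kappa LD_X^2}{k(k+1)(k+2)}$, $z_k=(1-\gamma_k)x_{k-1}+\gamma_kv_{k-1}$, $e_k=\epsilon_k/(64\kappa)$ and $R_k=\lceil\log_2(4D_X/\rho_k)\rceil$ with $\rho_k=4\gamma_k\sqrt{2\kappa Le_k/\alpha_k^2+2\zeta_k/\alpha_k}$. Start from $x^{(0)}=x_{k-1}$; for $r=1,\dots,R_k$, use CGS for $-f(x^{(r-1)},\cdot)$ on $Y$ from $y_{k-1}$ to compute $y^{(r)}$ with $f(x^{(r-1)},y^{(r)})\ge\max_{y\in Y}f(x^{(r-1)},y)-e_k$, and set $v^{(r)}=\mathrm{CndG}(\nabla_xf(z_k,y^{(r)}),v_{k-1},\alpha_k,\zeta_k,X)$, $x^{(r)}=(1-\gamma_k)x_{k-1}+\gamma_kv^{(r)}$. Then $(x_k,y_k,v_k)=(x^{(R_k)},y^{(R_k)},v^{(R_k)})$. The output is $x_N$ and $\bar y_N=\frac3{N(N+1)(N+2)}\sum_{s=1}^Ns(s+1)y_s$. In each call of CGS, $\delta=\delta_0(x^{(r-1)},y_{k-1})$, where $\delta_0$ is a given function with $\max_{y'\in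 Y}f(x,y')-f(x,y)\le\delta_0(x,y)$ and $0<\delta_0(x,y)\le\Delta$ on $X\times Y$. **Claim.** There are universal constants $C>0$ and $p\in\mathbb N$, a rule for $N$ depending only on $(\kappa,L,D_X,\epsilon)$ and a rule for the number $T$ of outer iterations of each CGS call depending only on $(\kappa,\delta,e_k)$, such that in every such problem, for all $x_0\in X$, $y_0\in Y$, all linear-optimization oracles of $X$ and $Y$, all $\delta_0,\Delta$ as above and every $\epsilon>0$, MPCGS terminates, every CGS call reaches its required accuracy, and $(x_N,\bar y_N)\in X\times Y$ is an $\epsilon$-saddle point, that is, $\max_{y\in Y}f(x_N,y)-\min_{x\in X}f(x,\bar y_N)\le\epsilon$. Moreover, with $\Lambda=\log(2+\kappa+LD_X^2/\epsilon+\Delta/\epsilon)$: if $\epsilon\le\kappa LD_X^2$, the number of FO calls is at most $$C\,\kappa\sqrt{LD_X^2/\epsilon}\;\Lambda^p,$$ and if also $\epsilon\le LD_Y^2$, the number of LO calls is at most $$C\,\frac{\kappa^2L^2D_X^2D_Y^2}{\epsilon^2}\;\Lambda^p.$$ -/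

import Mathlib

open scoped RealInnerProductSpace Gradient

noncomputable section

variable {α β : Type*}
variable {E : Type*} [NormedAddCommGroup E] [InnerProductSpace ℝ E] [CompleteSpace E]
variable {F : Type*} [NormedAddCommGroup F] [InnerProductSpace ℝ F] [CompleteSpace F]

/-! ### The saddle point problem -/

/-- The partial gradient of `f` with respect to the first variable. -/
def gradX (f : E → F → ℝ) (x : E) (y : F) : E := ∇ (fun x' => f x' y) x

/-- The partial gradient of `f` with respect to the second variable. -/
def gradY (f : E → F → ℝ) (x : E) (y : F) : F := ∇ (fun y' => f x y') y

/-- The standing assumptions on `min_{x ∈ X} max_{y ∈ Y} f x y`: compact convex feasible sets and a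
differentiable objective which is `L`-smooth on `X × Y`, convex in `x` and `μ`-strongly concave
in `y`. -/
structure IsConvexStronglyConcave (f : E → F → ℝ) (X : Set E) (Y : Set F) (L μ : ℝ) : Prop where
  L_pos : 0 < L
  mu_pos : 0 < μ
  convex_X : Convex ℝ X
  compact_X : IsCompact X
  convex_Y : Convex ℝ Y
  compact_Y : IsCompact Y
  differentiable : ∀ x ∈ X, ∀ y ∈ Y,
    DifferentiableAt ℝ (fun q : E × F => f q.1 q.2) (x, y)
  /-- The left-hand side is the squared Euclidean norm of the difference of the full gradients. -/
  smooth : ∀ x₁ ∈ X, ∀ y₁ ∈ Y, ∀ x₂ ∈ X, ∀ y₂ ∈ Y,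
    ‖gradX f x₁ y₁ - gradX f x₂ y₂‖ ^ 2 + ‖gradY f x₁ y₁ - gradY f x₂ y₂‖ ^ 2
      ≤ L ^ 2 * (‖x₁ - x₂‖ ^ 2 + ‖y₁ - y₂‖ ^ 2)
  convex : ∀ y ∈ Y, ∀ x₁ ∈ X, ∀ x₂ ∈ X,
    ⟪gradX f x₂ y, x₁ - x₂⟫ ≤ f x₁ y - f x₂ y
  strongly_concave : ∀ x ∈ X, ∀ y₁ ∈ Y, ∀ y₂ ∈ Y,
    f x y₁ - f x y₂ ≤ ⟪gradY f x y₂, y₁ - y₂⟫ - μ / 2 * ‖y₁ - y₂‖ ^ 2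

/-- `(x̂, ŷ)` is an `ε`-saddle point: it is feasible and
`max_{y ∈ Y} f x̂ y - min_{x ∈ X} f x ŷ ≤ ε`. -/
def IsSaddlePoint (f : E → F → ℝ) (X : Set E) (Y : Set F) (ε : ℝ) (xhat : E) (yhat : F) : Prop :=
  xhat ∈ X ∧ yhat ∈ Y ∧ ∃ a b : ℝ,
    IsGreatest ((fun y => f xhat y) '' Y) a ∧ IsLeast ((fun x => f x yhat) '' X) b ∧ a - b ≤ ε

/-- `lo` is a linear optimization oracle for `Ω`: on input `g` it returns a minimizer of `⟪v, g⟫`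
over `v ∈ Ω`. -/
def IsLinOracle (Ω : Set E) (lo : E → E) : Prop :=
  ∀ g, lo g ∈ Ω ∧ ∀ v ∈ Ω, ⟪lo g, g⟫ ≤ ⟪v, g⟫

/-! ### Programs with oracle counts

A program returns an element of `Option (Counted α)`: the value `none` means that the program does
not terminate (or that a call does not deliver what it is required to deliver). -/

/-- A value, with the numbers of first-order and of linear optimization oracle calls spent on it. -/
structure Counted (α : Type*) where
  val : α
  fo : ℕ
  lo : ℕ

/-- `for k = 1, …, n do s ← body k s`, started at `s = a`, adding up the oracle calls. -/
def forLoop (body : ℕ → α → Option (Counted α)) (a : α) : ℕ → Option (Counted α)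
  | 0 => some ⟨a, 0, 0⟩
  | n + 1 => (forLoop body a n).bind fun s =>
      (body (n + 1) s.val).map fun s' => ⟨s'.val, s.fo + s'.fo, s.lo + s'.lo⟩

/-! ### The procedure CndG -/

/-- The gradient `r + β (u - q)` at `u` of the quadratic that CndG minimizes. -/
def cndgGrad (r q : E) (β : ℝ) (u : E) : E := r + β • (u - q)

/-- The Frank-Wolfe gap `τ` at `u` (one call of the oracle `lo`). -/
def cndgGap (lo : E → E) (r q : E) (β : ℝ) (u : E) : ℝ :=
  ⟪cndgGrad r q β u, u - lo (cndgGrad r q β u)⟫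

/-- The step size `θ` at `u`. -/
def cndgStep (lo : E → E) (r q : E) (β : ℝ) (u : E) : ℝ :=
  min 1 (cndgGap lo r q β u / (β * ‖u - lo (cndgGrad r q β u)‖ ^ 2))

/-- The iterates of CndG: `cndgIter lo r q β t` is the iterate `q_{t+1}` (counted from `q_1 = q`). -/
def cndgIter (lo : E → E) (r q : E) (β : ℝ) : ℕ → E
  | 0 => q
  | t + 1 =>
      (1 - cndgStep lo r q β (cndgIter lo r q β t)) • cndgIter lo r q β t
        + cndgStep lo r q β (cndgIter lo r q β t) •
          lo (cndgGrad r q β (cndgIter lo r q β t))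

open Classical in
/-- `CndG(r, q, β, η, Ω)`, where `lo` is the oracle of `Ω`: return the first iterate whose gap is at
most `η`. One oracle call is made for each iterate that is visited, including the last one. -/
def cndg (lo : E → E) (r q : E) (β η : ℝ) : Option (Counted E) :=
  if h : ∃ t, cndgGap lo r q β (cndgIter lo r q β t) ≤ η then
    some ⟨cndgIter lo r q β (Nat.find h), 0, Nat.find h + 1⟩
  else none

/-! ### Conditional gradient sliding (CGS) for strongly convex functions -/

/-- The `k`-th inner iteration in the `t`-th outer iteration of CGS; the state is
`(x_{k-1}, u_{k-1})` and `N` is the total number of outer iterations. One first-order oracle call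
is made, for the gradient at `w_k`. -/
def cgsInnerStep (lo : E → E) (h : E → ℝ) (L μ δ₀ : ℝ) (N t k : ℕ) (s : E × E) :
    Option (Counted (E × E)) :=
  let lam : ℝ := 2 / (k + 1)
  let bet : ℝ := 2 * L / k
  let eta : ℝ := 8 * L * δ₀ * ((2 : ℝ) ^ t)⁻¹ / (μ * N * k)
  let w : E := (1 - lam) • s.1 + lam • s.2
  (cndg lo (∇ h w) s.2 bet eta).map fun u =>
    ⟨((1 - lam) • s.1 + lam • u.val, u.val), u.fo + 1, u.lo⟩

/-- CGS for the `L`-smooth and `μ`-strongly convex function `h`, with `N` outer iterations of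
`M = ⌈√(24 L / μ)⌉` inner iterations each, the starting point `xbar₀` and the parameter `δ₀`. -/
def cgs (lo : E → E) (h : E → ℝ) (L μ δ₀ : ℝ) (N : ℕ) (xbar₀ : E) : Option (Counted E) :=
  forLoop (fun t xbar =>
    (forLoop (cgsInnerStep lo h L μ δ₀ N t) (xbar, xbar) ⌈√(24 * L / μ)⌉₊).map fun s =>
      ⟨s.val.1, s.fo, s.lo⟩) xbar₀ N

/-! ### The procedure Prox-step -/

open Classical in
/-- One iteration of Prox-step; the state is `(x_{r-1}, y_{r-1}, v_{r-1})`. The number of outer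
iterations of CGS is `inner (L / μ) δ εcgs`, where `δ = δ₀ x_{r-1} y₀` is the upper bound on the
initial suboptimality `max_{y ∈ Y} f x_{r-1} y - f x_{r-1} y₀` that CGS takes as an input. The step
fails if the output of CGS is not an `εcgs`-approximate maximizer of `f x_{r-1}` over `Y`. The
gradient in `x` costs one more first-order oracle call. -/
def proxIter (loX : E → E) (loY : F → F) (Y : Set F) (f : E → F → ℝ) (L μ : ℝ)
    (δ₀ : E → F → ℝ) (inner : ℝ → ℝ → ℝ → ℕ) (x₀ : E) (y₀ : F) (z v : E) (γ α ζ εcgs : ℝ)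
    (s : E × F × E) : Option (Counted (E × F × E)) :=
  (cgs loY (fun y => -f s.1 y) L μ (δ₀ s.1 y₀) (inner (L / μ) (δ₀ s.1 y₀) εcgs) y₀).bind fun y =>
    if ∀ y' ∈ Y, f s.1 y' - εcgs ≤ f s.1 y.val then
      (cndg loX (gradX f z y.val) v α ζ).map fun u =>
        ⟨((1 - γ) • x₀ + γ • u.val, y.val, u.val), y.fo + u.fo + 1, y.lo + u.lo⟩
    else none

/-- The accuracy `ε_mp` of Prox-step. -/
def proxAccuracy (L μ γ α ζ εcgs : ℝ) : ℝ :=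
  4 * γ * √(2 * (L / μ) * L * εcgs / α ^ 2 + 2 * ζ / α)

/-- `Prox-step(f, x₀, y₀, z, v, γ, α, ζ, ε)`. -/
def proxStep (loX : E → E) (loY : F → F) (X : Set E) (Y : Set F) (f : E → F → ℝ) (L μ : ℝ)
    (δ₀ : E → F → ℝ) (inner : ℝ → ℝ → ℝ → ℕ) (x₀ : E) (y₀ : F) (z v : E) (γ α ζ ε : ℝ) :
    Option (Counted (E × F × E)) :=
  let εcgs : ℝ := ε / (64 * (L / μ))
  let R : ℕ := ⌈Real.logb 2 (4 * Metric.diam X / proxAccuracy L μ γ α ζ εcgs)⌉₊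
  forLoop (fun _ s => proxIter loX loY Y f L μ δ₀ inner x₀ y₀ z v γ α ζ εcgs s) (x₀, y₀, v) R

/-! ### Mirror-Prox conditional gradient sliding (MPCGS) -/

/-- The state of MPCGS after `k` iterations: `x_k`, `y_k`, `v_k` and
`ysum = ∑_{s = 1}^k s (s + 1) y_s`. -/
structure MPState (E F : Type*) where
  x : E
  y : F
  v : E
  ysum : F

/-- The `k`-th iteration of MPCGS. -/
def mpcgsStep (loX : E → E) (loY : F → F) (X : Set E) (Y : Set F) (f : E → F → ℝ) (L μ : ℝ)
    (δ₀ : E → F → ℝ) (inner : ℝ → ℝ → ℝ → ℕ) (γ α ζ ε : ℕ → ℝ) (k : ℕ) (s : MPState E F) :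
    Option (Counted (MPState E F)) :=
  let z : E := (1 - γ k) • s.x + γ k • s.v
  (proxStep loX loY X Y f L μ δ₀ inner s.x s.y z s.v (γ k) (α k) (ζ k) (ε k)).map fun o =>
    ⟨⟨o.val.1, o.val.2.1, o.val.2.2, s.ysum + ((k : ℝ) * (k + 1)) • o.val.2.1⟩, o.fo, o.lo⟩

/-- MPCGS with `N` iterations, started at `(x₀, y₀)`; the output is `(x_N, ȳ_N)`. -/
def mpcgs (loX : E → E) (loY : F → F) (X : Set E) (Y : Set F) (f : E → F → ℝ) (L μ : ℝ)
    (δ₀ : E → F → ℝ) (inner : ℝ → ℝ → ℝ → ℕ) (γ α ζ ε : ℕ → ℝ) (N : ℕ) (x₀ : E) (y₀ : F) :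
    Option (Counted (E × F)) :=
  (forLoop (mpcgsStep loX loY X Y f L μ δ₀ inner γ α ζ ε) ⟨x₀, y₀, x₀, 0⟩ N).map fun s =>
    ⟨(s.val.x, (3 / ((N : ℝ) * (N + 1) * (N + 2))) • s.val.ysum), s.fo, s.lo⟩

/-! ### The parameters, for condition number `κ` and diameter `D` of `X` -/

def gammaParam (k : ℕ) : ℝ := 3 / (k + 2)

def alphaParam (κ L : ℝ) (k : ℕ) : ℝ := 6 * κ * L / (k + 1)

def zetaParam (L D : ℝ) (k : ℕ) : ℝ := L * D ^ 2 / (384 * k * (k + 1))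

def epsParam (κ L D : ℝ) (k : ℕ) : ℝ := κ * L * D ^ 2 / (k * (k + 1) * (k + 2))

/-- The logarithmic factor hidden in the soft-O notation. -/
def logFactor (κ L D Δ ε : ℝ) : ℝ := Real.log (2 + κ + L * D ^ 2 / ε + Δ / ε)

end

/-! Write P = κL. Suppose first that y_k maximizes f(x_k,·) while x_k results from an accelerated
prox step on f(·,y_k). The accelerated estimate for this frozen function, weighted by k(k+1)(k+2),
telescopes: f(x_{k-1},y_k) is controlled by the previous estimate tested at y = y_k, and concavity
in y merges f(x,ȳ_{k-1}) and f(x,y_k) into f(x,ȳ_k). The weighted inexactness costs O(P D_X²) per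
round, so the gap after N rounds is at most 12 P D_X²/N² (`mpcgsStep_spec`, `mpcgs_spec`).

That x_k and y_k depend on each other is a fixed point problem. The map x ↦ argmax f(x,·) is
κ-Lipschitz, the prox mapping multiplies gradient changes by 1/α, and averaging contributes γ; hence
one round contracts by κLγ/α ≤ 1/2 up to errors, and logarithmically many rounds suffice. Replacing
the point at which y is nearly optimal by the final x_k costs only the square of their distance
(`argmax_lipschitz`, `prox_dist_le`, `near_argmax_transfer`, `proxStep_spec`).

The maximizations in y use restarted acceleration: a stage of order √κ steps cuts the gap to a sixth
plus an error (`cgs_spec`). Each prox subproblem takes O(βD²/η) Frank-Wolfe steps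
(`frankWolfe_count`, `cndg_spec`).

Up to logarithms, FO calls number N√κ with N of order √(κLD_X²/ε). Accuracy e of order LD_X²/N³
makes one CGS call cost √κ · μ√κ D_Y²/e = LD_Y²/e LO calls, hence N⁴D_Y²/D_X² in total; the calls
over X add κN², which the condition ε ≤ LD_Y² absorbs (`oracle_calls_le`). -/

section Loops

variable {α : Type*}

/-- An invariant of a loop is preserved, and bounds on the cost of one round add up. -/
theorem forLoop_invariant (body : ℕ → α → Option (Counted α)) (P : ℕ → α → Prop) (A B : ℝ)
    (a : α) (n : ℕ) (h0 : P 0 a)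
    (h : ∀ k < n, ∀ s, P k s → ∃ s', body (k + 1) s = some s' ∧ P (k + 1) s'.val ∧
      (s'.fo : ℝ) ≤ A ∧ (s'.lo : ℝ) ≤ B) :
    ∃ out, forLoop body a n = some out ∧ P n out.val ∧
      (out.fo : ℝ) ≤ n * A ∧ (out.lo : ℝ) ≤ n * B := by
  induction n with
  | zero => exact ⟨⟨a, 0, 0⟩, rfl, h0, by simp, by simp⟩
  | succ n ih =>
    obtain ⟨o, ho, hP, hfo, hlo⟩ := ih fun k hk => h k (by omega)
    obtain ⟨s', hs', hP', hfo', hlo'⟩ := h n (by omega) o.val hP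
    refine ⟨⟨s'.val, o.fo + s'.fo, o.lo + s'.lo⟩, ?_, hP', ?_, ?_⟩
    · simp [forLoop, ho, hs']
    · push_cast; linarith
    · push_cast; linarith

end Loops

/-! ### Frank-Wolfe on a quadratic: the procedure CndG -/

section FrankWolfe

variable {E : Type*} [NormedAddCommGroup E] [InnerProductSpace ℝ E]

/-- If the Frank-Wolfe gap `τ` exceeds `η` during `K` steps, then `K ≤ 8 c / η + 9`. -/
theorem frankWolfe_count (h τ : ℕ → ℝ) (c η : ℝ) (K : ℕ) (hη : 0 < η) (hc : 0 ≤ c)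
    (h_nonneg : ∀ t, 0 ≤ h t) (hle : ∀ t, h t ≤ τ t) (hτ : ∀ t < K, η < τ t)
    (hstep : ∀ t < K, ∀ θ : ℝ, 0 ≤ θ → θ ≤ 1 →
      h (t + 1) ≤ h t - θ * τ t + θ ^ 2 * (c / 2)) :
    (K : ℝ) ≤ 8 * c / η + 9 := by
  have hc' : 0 < c + η := by linarith
  -- While τ exceeds both h and η, it exceeds their mean (h + η)/2, so h + η itself decays like 1/t.
  -- As h ≥ 0, this bounds the number of steps with τ > η directly.
  have key : ∀ t : ℕ, t + 1 ≤ K →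
      t * (h (t + 1) + η) ≤ 8 * (c + η) ∧ h (t + 1) ≤ (c + η) / 2 := by
    intro t
    induction t with
    | zero =>
      intro ht
      have h1 := hstep 0 (by omega) 1 (by norm_num) le_rfl
      have h2 := hle 0
      constructor
      · simp; linarith
      · simp only [zero_add] at h1 ⊢; linarith
    | succ t ih =>
      intro ht
      obtain ⟨ih1, ih2⟩ := ih (by omega)
      have hn := h_nonneg (t + 1)
      have hl := hle (t + 1)
      have ht' := hτ (t + 1) (by omega)
      set x := (h (t + 1) + η) / (8 * (c + η)) with hx
      have hgx : h (t + 1) + η = 8 * (c + η) * x := by rw [hx]; field_simp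
      have hx0 : 0 ≤ x := by positivity
      have hx4 : x ≤ 1 / 4 := by
        rw [hx, div_le_iff₀ (by positivity)]; linarith
      -- The step 4x = (h + η)/(2(c + η)) is the best one for τ = (h + η)/2 and curvature c + η; it
      -- turns x into at most x - x². The bound x ≤ 1/4, secured by the first full step, makes it
      -- admissible.
      have hs := hstep (t + 1) (by omega) (4 * x) (by linarith) (by linarith)
      have hτx : 4 * (c + η) * x ≤ τ (t + 1) := by linarith
      have h3 : 4 * x * (4 * (c + η) * x) ≤ 4 * x * τ (t + 1) :=
        mul_le_mul_of_nonneg_left hτx (by linarith)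
      have h4 : (4 * x) ^ 2 * (c / 2) ≤ (4 * x) ^ 2 * ((c + η) / 2) :=
        mul_le_mul_of_nonneg_left (by linarith) (by positivity)
      have h5 : h (t + 1 + 1) + η ≤ 8 * (c + η) * (x - x ^ 2) := by nlinarith
      have htx : t * x ≤ 1 := by
        rw [hgx] at ih1
        have : 8 * (c + η) * (t * x) ≤ 8 * (c + η) * 1 := by linarith
        exact le_of_mul_le_mul_left this (by positivity)
      constructor
      · push_cast
        have h6 : ((t : ℝ) + 1) * (x - x ^ 2) ≤ 1 := by
          have : t * x * (1 - x) ≤ 1 * (1 - x) :=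
            mul_le_mul_of_nonneg_right htx (by linarith)
          nlinarith
        calc ((t : ℝ) + 1) * (h (t + 1 + 1) + η)
            ≤ (t + 1) * (8 * (c + η) * (x - x ^ 2)) :=
              mul_le_mul_of_nonneg_left h5 (by positivity)
          _ = 8 * (c + η) * ((t + 1) * (x - x ^ 2)) := by ring
          _ ≤ 8 * (c + η) * 1 := mul_le_mul_of_nonneg_left h6 (by positivity)
          _ = _ := by ring
      · have : 8 * (c + η) * (x - x ^ 2) ≤ 8 * (c + η) * x :=
          mul_le_mul_of_nonneg_left (by nlinarith) (by positivity)
        linarith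
  rcases K with _ | K
  · simp; positivity
  · have h1 := (key K le_rfl).1
    have h2 : K * η ≤ K * (h (K + 1) + η) :=
      mul_le_mul_of_nonneg_left (by linarith [h_nonneg (K + 1)]) (by positivity)
    have h3 : (K : ℝ) ≤ 8 * (c + η) / η := by
      rw [le_div_iff₀ hη]; linarith
    have h4 : 8 * (c + η) / η = 8 * c / η + 8 := by field_simp
    push_cast; linarith

/-- The step size `min 1 (τ / b)` minimizes `-θ τ + θ² b / 2` over `[0, 1]`. -/
theorem clipped_step_optimal (τ b θ : ℝ) (hb : 0 < b) (h1 : θ ≤ 1) :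
    -(min 1 (τ / b)) * τ + (min 1 (τ / b)) ^ 2 * b / 2 ≤ -θ * τ + θ ^ 2 * b / 2 := by
  rcases le_total 1 (τ / b) with h | h
  · rw [min_eq_left h]
    rw [le_div_iff₀ hb] at h
    have : 0 ≤ (1 - θ) * (τ - (1 + θ) / 2 * b) :=
      mul_nonneg (by linarith) (by nlinarith)
    nlinarith
  · rw [min_eq_right h]
    have : τ = τ / b * b := by field_simp
    set y := τ / b
    rw [this]
    nlinarith [mul_nonneg hb.le (sq_nonneg (θ - y))]

theorem cndgIter_mem {Ω : Set E} (hconv : Convex ℝ Ω) {lo : E → E} (hlo : IsLinOracle Ω lo)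
    {r q : E} (hq : q ∈ Ω) {β : ℝ} {t : ℕ}
    (hgap : ∀ s < t, 0 ≤ cndgStep lo r q β (cndgIter lo r q β s)) :
    cndgIter lo r q β t ∈ Ω := by
  induction t with
  | zero => exact hq
  | succ t ih =>
    refine hconv (ih fun s hs => hgap s (by omega)) (hlo _).1 ?_ (hgap t (by omega)) (by ring)
    have : cndgStep lo r q β (cndgIter lo r q β t) ≤ 1 := min_le_left _ _
    linarith

theorem cndgGap_nonneg {Ω : Set E} {lo : E → E} (hlo : IsLinOracle Ω lo) (r q : E) (β : ℝ)
    {u : E} (hu : u ∈ Ω) : 0 ≤ cndgGap lo r q β u := by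
  have := (hlo (cndgGrad r q β u)).2 u hu
  rw [cndgGap, inner_sub_right, real_inner_comm u, real_inner_comm (lo _)]
  linarith

theorem inner_le_cndgGap {Ω : Set E} {lo : E → E} (hlo : IsLinOracle Ω lo) (r q : E) (β : ℝ)
    (u : E) {v : E} (hv : v ∈ Ω) : ⟪cndgGrad r q β u, u - v⟫ ≤ cndgGap lo r q β u := by
  have := (hlo (cndgGrad r q β u)).2 v hv
  rw [cndgGap, inner_sub_right, inner_sub_right, real_inner_comm v, real_inner_comm (lo _)]
  linarith

/-- The quadratic minimized by CndG, expanded around `u`. -/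
theorem prox_quadratic_expand (r q u v : E) (β : ℝ) :
    ⟪r, v⟫ + β / 2 * ‖v - q‖ ^ 2 =
      ⟪r, u⟫ + β / 2 * ‖u - q‖ ^ 2 + ⟪cndgGrad r q β u, v - u⟫ + β / 2 * ‖v - u‖ ^ 2 := by
  have h1 : v - q = (u - q) + (v - u) := by abel
  rw [h1, norm_add_sq_real, cndgGrad, inner_add_left, inner_smul_left, inner_sub_right r v u]
  simp only [conj_trivial]
  ring

/-- CndG terminates; its output has Frank-Wolfe gap at most `η`, after at most
`8 β D² / η + 10` calls of the oracle. -/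
theorem cndg_spec {Ω : Set E} (hconv : Convex ℝ Ω) (hcomp : IsCompact Ω) {D : ℝ}
    (hD : ∀ a ∈ Ω, ∀ b ∈ Ω, ‖a - b‖ ≤ D) {lo : E → E} (hlo : IsLinOracle Ω lo)
    (r : E) {q : E} (hq : q ∈ Ω) {β η : ℝ} (hβ : 0 < β) (hη : 0 < η) :
    ∃ out, cndg lo r q β η = some out ∧ out.val ∈ Ω ∧
      (∀ u ∈ Ω, ⟪r + β • (out.val - q), out.val - u⟫ ≤ η) ∧ out.fo = 0 ∧
      (out.lo : ℝ) ≤ 8 * (β * D ^ 2) / η + 10 := by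
  set it := cndgIter lo r q β with hit
  set φ : E → ℝ := fun v => ⟪r, v⟫ + β / 2 * ‖v - q‖ ^ 2 with hφ
  have hstep_nonneg : ∀ u ∈ Ω, 0 ≤ cndgStep lo r q β u := fun u hu =>
    le_min zero_le_one (div_nonneg (cndgGap_nonneg hlo r q β hu) (by positivity))
  have hmem : ∀ t, it t ∈ Ω := by
    intro t
    -- Membership of an iterate needs nonnegative earlier steps, which in turn needs membership of
    -- the earlier iterates.
    induction t using Nat.strong_induction_on with
    | _ t ih => exact cndgIter_mem hconv hlo hq fun s hs => hstep_nonneg _ (ih s hs)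
  obtain ⟨v, hv, hmin⟩ := hcomp.exists_isMinOn ⟨q, hq⟩
    (f := φ) (by rw [hφ]; fun_prop)
  have hD0 : 0 ≤ D := by simpa using hD q hq q hq
  have count : ∀ K : ℕ, (∀ t < K, η < cndgGap lo r q β (it t)) →
      (K : ℝ) ≤ 8 * (β * D ^ 2) / η + 9 := by
    intro K hK
    refine frankWolfe_count (fun t => φ (it t) - φ v) (fun t => cndgGap lo r q β (it t))
      (β * D ^ 2) η K hη (by positivity) (fun t => sub_nonneg.2 (hmin (hmem t))) ?_ hK ?_
    · intro t
      have h1 := prox_quadratic_expand r q (it t) v β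
      have h2 := inner_le_cndgGap hlo r q β (it t) hv
      rw [← neg_sub, inner_neg_right] at h2
      have h3 : 0 ≤ β / 2 * ‖v - it t‖ ^ 2 := by positivity
      simp only [hφ]
      linarith
    · intro t ht θ hθ0 hθ1
      set u := it t with hu
      set p := lo (cndgGrad r q β u) with hp
      set θ' := cndgStep lo r q β u with hθ'
      have hgap := hK t ht
      -- A gap above η > 0 rules out u = p, so the step size has a genuine denominator.
      have hup : 0 < ‖u - p‖ := by
        rw [norm_pos_iff]
        intro h0
        rw [cndgGap, ← hp, h0, inner_zero_right] at hgap
        linarith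
      have hnext : it (t + 1) - u = θ' • (p - u) := by
        change (1 - θ') • u + θ' • p - u = _
        module
      have h1 := prox_quadratic_expand r q u (it (t + 1)) β
      rw [hnext, inner_smul_right, norm_smul, mul_pow, Real.norm_eq_abs, sq_abs] at h1
      have h2 : ⟪cndgGrad r q β u, p - u⟫ = -cndgGap lo r q β u := by
        rw [cndgGap, ← inner_neg_right, neg_sub]
      rw [h2, norm_sub_rev p u] at h1
      have h3 := clipped_step_optimal (cndgGap lo r q β u) (β * ‖u - p‖ ^ 2) θ
        (by positivity) hθ1
      have h4 : min 1 (cndgGap lo r q β u / (β * ‖u - p‖ ^ 2)) = θ' := rfl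
      rw [h4] at h3
      have h5 : θ ^ 2 * (β * ‖u - p‖ ^ 2) ≤ θ ^ 2 * (β * D ^ 2) := by
        have := hD u (hmem t) p (hlo _).1
        gcongr
      simp only [hφ]
      linarith
  have hex : ∃ t, cndgGap lo r q β (it t) ≤ η := by
    by_contra! hcon
    obtain ⟨K, hK⟩ := exists_nat_gt (8 * (β * D ^ 2) / η + 9)
    linarith [count K fun t _ => hcon t]
  classical
  refine ⟨⟨it (Nat.find hex), 0, Nat.find hex + 1⟩, ?_, hmem _, ?_, rfl, ?_⟩
  · rw [cndg, dif_pos hex]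
  · intro u hu
    exact (inner_le_cndgGap hlo r q β _ hu).trans (Nat.find_spec hex)
  · have := count (Nat.find hex) fun t ht => not_le.1 (Nat.find_min hex ht)
    push_cast; linarith

end FrankWolfe

/-! ### Descent lemma and the accelerated step -/

section Smooth

variable {E : Type*} [NormedAddCommGroup E] [InnerProductSpace ℝ E]

/-- The descent lemma on a convex set. -/
theorem descent_of_lipschitz_gradient [CompleteSpace E] {s : Set E} (hs : Convex ℝ s)
    {h : E → ℝ} {g : E → E} {L : ℝ} (hg : ∀ z ∈ s, HasGradientAt h (g z) z)
    (hL : ∀ a ∈ s, ∀ b ∈ s, ‖g a - g b‖ ≤ L * ‖a - b‖) {a b : E} (ha : a ∈ s) (hb : b ∈ s) :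
    h b ≤ h a + ⟪g a, b - a⟫ + L / 2 * ‖b - a‖ ^ 2 := by
  set γ : ℝ → E := fun t => a + t • (b - a) with hγ
  have hmem : ∀ t ∈ Set.Icc (0 : ℝ) 1, γ t ∈ s := fun t ht => hs.add_smul_sub_mem ha hb ht
  -- Along the segment, h minus its claimed upper model has nonpositive derivative by the Lipschitz
  -- bound; comparing its values at 0 and 1 replaces an integral.
  have hd : ∀ t ∈ Set.Icc (0 : ℝ) 1, HasDerivAt
      (fun t => h (γ t) - t * ⟪g a, b - a⟫ - L / 2 * ‖b - a‖ ^ 2 * t ^ 2)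
      (⟪g (γ t), b - a⟫ - ⟪g a, b - a⟫ - L * ‖b - a‖ ^ 2 * t) t := by
    intro t ht
    have h1 : HasDerivAt γ (b - a) t := 
      (((hasDerivAt_id t).smul_const (b - a)).const_add a).congr_deriv (one_smul ℝ _)
    have h2 := (hg _ (hmem t ht)).hasFDerivAt.comp_hasDerivAt t h1
    have h3 := (h2.sub ((hasDerivAt_id t).mul_const ⟪g a, b - a⟫)).sub
      ((hasDerivAt_pow 2 t).const_mul (L / 2 * ‖b - a‖ ^ 2))
    refine h3.congr_deriv ?_
    simp only [InnerProductSpace.toDual_apply_apply, one_mul, Nat.cast_ofNat]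
    ring
  have hanti := antitoneOn_of_deriv_nonpos (convex_Icc (0 : ℝ) 1)
    (fun t ht => (hd t ht).continuousAt.continuousWithinAt)
    (fun t ht => (hd t (interior_subset ht)).differentiableAt.differentiableWithinAt)
    (fun t ht => by
      have ht' := interior_subset ht
      rw [(hd t ht').deriv, ← inner_sub_left]
      have h1 := real_inner_le_norm (g (γ t) - g a) (b - a)
      have h2 := hL _ (hmem t ht') _ ha
      have h3 : γ t - a = t • (b - a) := by simp [hγ]
      rw [h3, norm_smul, Real.norm_eq_abs, abs_of_nonneg ht'.1] at h2
      have h4 := mul_le_mul_of_nonneg_right h2 (norm_nonneg (b - a))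
      nlinarith)
  have := hanti (Set.left_mem_Icc.2 zero_le_one) (Set.right_mem_Icc.2 zero_le_one) zero_le_one
  simp [hγ] at this
  linarith

/-- One step of an accelerated method with an inexact prox-mapping. -/
theorem accelerated_step (φ : E → ℝ) (g x u u' c w x' : E) (L lam β η : ℝ)
    (hlam0 : 0 ≤ lam) (hlam1 : lam ≤ 1) (hβ : L * lam ≤ β)
    (hw : w = (1 - lam) • x + lam • u) (hx' : x' = (1 - lam) • x + lam • u')
    (hdescent : φ x' ≤ φ w + ⟪g, x' - w⟫ + L / 2 * ‖x' - w‖ ^ 2)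
    (hx : φ w + ⟪g, x - w⟫ ≤ φ x) (hc : φ w + ⟪g, c - w⟫ ≤ φ c)
    (hgap : ⟪g + β • (u' - u), u' - c⟫ ≤ η) :
    φ x' ≤ (1 - lam) * φ x + lam * φ c + lam * η
      + lam * β / 2 * (‖u - c‖ ^ 2 - ‖u' - c‖ ^ 2) := by
  have h1 : x' - w = lam • (u' - u) := by rw [hx', hw]; module
  -- The first two terms are bounded by the linear lower models at x and c, the last one by the gap
  -- of the inexact prox step.
  have h2 : ⟪g, x' - w⟫ = (1 - lam) * ⟪g, x - w⟫ + lam * (⟪g, c - w⟫ + ⟪g, u' - c⟫) := by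
    rw [← inner_add_right, ← inner_smul_right, ← inner_smul_right, ← inner_add_right]
    congr 1
    rw [hx']; module
  have h3 : ‖x' - w‖ ^ 2 = lam ^ 2 * ‖u' - u‖ ^ 2 := by
    rw [h1, norm_smul, mul_pow, Real.norm_eq_abs, sq_abs]
  have h4 : ‖u - c‖ ^ 2 = ‖u' - u‖ ^ 2 - 2 * ⟪u' - u, u' - c⟫ + ‖u' - c‖ ^ 2 := by
    have : u - c = (u' - c) - (u' - u) := by abel
    rw [this, norm_sub_sq_real, real_inner_comm]; ring
  rw [inner_add_left, inner_smul_left, conj_trivial] at hgap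
  rw [h2, h3] at hdescent
  have h5 := mul_le_mul_of_nonneg_left hx (sub_nonneg.2 hlam1)
  have h6 := mul_le_mul_of_nonneg_left hc hlam0
  have h7 := mul_le_mul_of_nonneg_left hgap hlam0
  have h8 : L * lam * (lam * ‖u' - u‖ ^ 2) ≤ β * (lam * ‖u' - u‖ ^ 2) :=
    mul_le_mul_of_nonneg_right hβ (by positivity)
  have h9 : lam * β / 2 * (‖u - c‖ ^ 2 - ‖u' - c‖ ^ 2) =
      β * (lam * ‖u' - u‖ ^ 2) / 2 - lam * (β * ⟪u' - u, u' - c⟫) := by rw [h4]; ring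
  rw [h9]
  nlinarith

end Smooth

/-! ### Conditional gradient sliding with restarts -/

section Sliding

variable {E : Type*} [NormedAddCommGroup E] [InnerProductSpace ℝ E]

/-- A strongly convex function grows quadratically away from its minimizer. -/
theorem quadratic_growth_of_strongly_convex {Ω : Set E} (hconv : Convex ℝ Ω) {h : E → ℝ}
    {g : E → E} {μ : ℝ} (hμ : 0 < μ)
    (hsc : ∀ a ∈ Ω, ∀ b ∈ Ω, h b + ⟪g b, a - b⟫ + μ / 2 * ‖a - b‖ ^ 2 ≤ h a)
    {c : E} (hc : c ∈ Ω) (hmin : ∀ a ∈ Ω, h c ≤ h a) {a : E} (ha : a ∈ Ω) :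
    h c + μ / 2 * ‖a - c‖ ^ 2 ≤ h a := by
  set B := μ / 2 * ‖a - c‖ ^ 2 with hB
  have hB0 : 0 ≤ B := by positivity
  -- Strong convexity at a point z of the segment, averaged over its two ends, is compared with h c
  -- ≤ h z. Letting t tend to 0 gives the growth, with no first-order optimality condition at c.
  have key : ∀ t : ℝ, 0 < t → t ≤ 1 → B * (1 - t) ≤ h a - h c := by
    intro t ht0 ht1
    set z := c + t • (a - c) with hz
    have hzΩ : z ∈ Ω := hconv.add_smul_sub_mem hc ha ⟨ht0.le, ht1⟩
    have h1 := hsc a ha z hzΩ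
    have h2 := hsc c hc z hzΩ
    have e1 : a - z = (1 - t) • (a - c) := by rw [hz]; module
    have e2 : c - z = (-t) • (a - c) := by rw [hz]; module
    rw [e1, inner_smul_right, norm_smul, mul_pow, Real.norm_eq_abs, sq_abs] at h1
    rw [e2, inner_smul_right, norm_smul, mul_pow, Real.norm_eq_abs, sq_abs] at h2
    have h3 := hmin z hzΩ
    have h4 := mul_le_mul_of_nonneg_left h1 ht0.le
    have h5 := mul_le_mul_of_nonneg_left h2 (sub_nonneg.2 ht1)
    have h6 : t * (B * (1 - t)) ≤ t * (h a - h c) := by rw [hB]; nlinarith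
    exact le_of_mul_le_mul_left h6 ht0
  by_contra! hlt
  have hd := hmin a ha
  have hBpos : 0 < B := by linarith
  -- This t makes B(1 - t) the midpoint of B and h a - h c, which contradicts a growth below B.
  have h1 := key ((B - (h a - h c)) / (2 * B)) (by apply div_pos <;> linarith)
    (by rw [div_le_one (by linarith)]; linarith)
  have h2 : B * (1 - (B - (h a - h c)) / (2 * B)) = (B + (h a - h c)) / 2 := by
    field_simp; ring
  linarith

/-- Two approximate prox-mappings differ by at most the difference of their inputs, up to the
error. -/
theorem prox_dist_le {g g' v₀ v v' : E} {α ζ : ℝ} (hα : 0 < α) (hζ : 0 ≤ ζ)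
    (h : ⟪g + α • (v - v₀), v - v'⟫ ≤ ζ) (h' : ⟪g' + α • (v' - v₀), v' - v⟫ ≤ ζ) :
    ‖v' - v‖ ≤ ‖g' - g‖ / α + √(2 * ζ / α) := by
  have e1 : α * ‖v' - v‖ ^ 2 = ⟪g + α • (v - v₀), v - v'⟫ + ⟪g' + α • (v' - v₀), v' - v⟫
      - ⟪g' - g, v' - v⟫ := by
    have : α * ‖v' - v‖ ^ 2 = ⟪α • (v' - v), v' - v⟫ := by
      rw [inner_smul_left, real_inner_self_eq_norm_sq]; simp
    rw [this, ← neg_sub v' v, inner_neg_right, ← inner_neg_left, ← inner_add_left,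
      ← inner_sub_left]
    congr 1
    module
  have h1 : -⟪g' - g, v' - v⟫ ≤ ‖g' - g‖ * ‖v' - v‖ :=
    (neg_le_abs _).trans (abs_real_inner_le_norm _ _)
  set t := ‖v' - v‖ with ht
  set p := ‖g' - g‖ / α with hp
  have hp0 : 0 ≤ p := by positivity
  have h2 : t ^ 2 ≤ p * t + 2 * ζ / α := by
    have : p * t + 2 * ζ / α = (‖g' - g‖ * t + 2 * ζ) / α := by rw [hp]; ring
    rw [this, le_div_iff₀ hα]
    linarith
  -- With s = √(2ζ/α), t > p + s would give t(t - p) > s², against `h2`.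
  by_contra! hlt
  have hs : √(2 * ζ / α) ^ 2 = 2 * ζ / α := Real.sq_sqrt (by positivity)
  have hs0 := Real.sqrt_nonneg (2 * ζ / α)
  nlinarith

variable [CompleteSpace E]

/-- The inner loop of CGS. -/
theorem cgs_inner_loop {Ω : Set E} (hconv : Convex ℝ Ω) (hcomp : IsCompact Ω) {D : ℝ}
    (hD : ∀ a ∈ Ω, ∀ b ∈ Ω, ‖a - b‖ ≤ D) {lo : E → E} (hlo : IsLinOracle Ω lo)
    {h : E → ℝ} {L μ δ : ℝ} (hL : 0 < L) (hμ : 0 < μ) (hδ : 0 < δ)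
    (hdescent : ∀ a ∈ Ω, ∀ b ∈ Ω, h b ≤ h a + ⟪∇ h a, b - a⟫ + L / 2 * ‖b - a‖ ^ 2)
    (hcvx : ∀ a ∈ Ω, ∀ b ∈ Ω, h b + ⟪∇ h b, a - b⟫ ≤ h a)
    {c : E} (hc : c ∈ Ω) {T : ℕ} (hT : 0 < T) (t : ℕ) {x : E} (hx : x ∈ Ω) (M : ℕ) :
    ∃ out, forLoop (cgsInnerStep lo h L μ δ T t) (x, x) M = some out ∧ out.val.1 ∈ Ω ∧
      (M : ℝ) * (M + 1) / 2 * (h out.val.1 - h c) ≤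
        L * ‖x - c‖ ^ 2 + M * (8 * L * δ * ((2 : ℝ) ^ t)⁻¹ / (μ * T)) ∧
      (out.fo : ℝ) ≤ M ∧ (out.lo : ℝ) ≤ M * (2 * μ * T * 2 ^ t * D ^ 2 / δ + 10) := by
  set σ := 8 * L * δ * ((2 : ℝ) ^ t)⁻¹ / (μ * T) with hσ
  have hT' : (0 : ℝ) < T := by exact_mod_cast hT
  have hσ0 : 0 < σ := by positivity
  refine Exists.imp ?_ (forLoop_invariant (cgsInnerStep lo h L μ δ T t)
    -- The weight k(k+1)/2 makes the coefficient of the squared distance the constant L, and each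
    -- CndG tolerance then contributes exactly σ. The ratio β/η does not depend on k, hence neither
    -- does the bound on LO calls.
    (fun k s => s.1 ∈ Ω ∧ s.2 ∈ Ω ∧ (k : ℝ) * (k + 1) / 2 * (h s.1 - h c) + L * ‖s.2 - c‖ ^ 2 ≤
      L * ‖x - c‖ ^ 2 + k * σ) 1 (2 * μ * T * 2 ^ t * D ^ 2 / δ + 10) (x, x) M
    ⟨hx, hx, by simp⟩ ?_)
  · rintro out ⟨h1, h2, h3, h4⟩
    refine ⟨h1, h2.1, ?_, by simpa using h3, h4⟩
    have : 0 ≤ L * ‖out.val.2 - c‖ ^ 2 := by positivity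
    linarith [h2.2.2]
  rintro k - ⟨a, u⟩ ⟨ha, hu, hinv⟩
  dsimp only at ha hu hinv
  simp only [cgsInnerStep]
  push_cast
  have hk : (0 : ℝ) < (k : ℝ) + 1 := by positivity
  set lam : ℝ := 2 / ((k : ℝ) + 1 + 1) with hlam
  have hlam0 : 0 ≤ lam := by positivity
  have hlam1 : lam ≤ 1 := by rw [hlam, div_le_one (by positivity)]; linarith
  set w := (1 - lam) • a + lam • u with hw
  have hwΩ : w ∈ Ω := hconv ha hu (by linarith) hlam0 (by ring)
  have hη : 8 * L * δ * ((2 : ℝ) ^ t)⁻¹ / (μ * T * (k + 1)) = σ / (k + 1) := by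
    rw [hσ]; field_simp
  rw [hη]
  obtain ⟨o, ho, hoΩ, hgap, hofo, holo⟩ := cndg_spec hconv hcomp hD hlo (∇ h w) hu
    (β := 2 * L / (k + 1)) (η := σ / (k + 1)) (by positivity) (by positivity)
  rw [ho]
  refine ⟨_, rfl, ⟨hconv ha hoΩ (by linarith) hlam0 (by ring), hoΩ, ?_⟩, by simp [hofo], ?_⟩
  · have hx'Ω : (1 - lam) • a + lam • o.val ∈ Ω := hconv ha hoΩ (by linarith) hlam0 (by ring)
    have key := accelerated_step h (∇ h w) a u o.val c w ((1 - lam) • a + lam • o.val) L lam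
      (2 * L / (k + 1)) (σ / (k + 1)) hlam0 hlam1
      (by rw [hlam, mul_div_assoc', mul_comm L 2]; gcongr; linarith)
      rfl rfl (hdescent _ hwΩ _ hx'Ω) (hcvx _ ha _ hwΩ) (hcvx _ hc _ hwΩ) (hgap c hc)
    have e1 : 1 - lam = k / (k + 1 + 1) := by rw [hlam]; field_simp; ring
    have hpos : (0 : ℝ) ≤ (k + 1) * (k + 1 + 1) / 2 := by positivity
    have h5 := mul_le_mul_of_nonneg_left key hpos
    have e2 : ((k : ℝ) + 1) * (k + 1 + 1) / 2 * ((1 - lam) * h a + lam * h c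
        + lam * (σ / (k + 1)) + lam * (2 * L / (k + 1)) / 2 * (‖u - c‖ ^ 2 - ‖o.val - c‖ ^ 2)) =
        k * (k + 1) / 2 * h a + (k + 1) * h c + σ + L * (‖u - c‖ ^ 2 - ‖o.val - c‖ ^ 2) := by
      rw [e1, hlam]; field_simp
    rw [e2] at h5
    linarith
  · refine holo.trans (le_of_eq ?_)
    rw [hσ]; field_simp

/-- CGS: after `T` outer iterations the optimality gap is at most
`7 √(L / μ) δ 2⁻ᵀ`. -/
theorem cgs_spec {Ω : Set E} (hconv : Convex ℝ Ω) (hcomp : IsCompact Ω) {D : ℝ}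
    (hD : ∀ a ∈ Ω, ∀ b ∈ Ω, ‖a - b‖ ≤ D) {lo : E → E} (hlo : IsLinOracle Ω lo)
    {h : E → ℝ} {L μ δ : ℝ} (hμ : 0 < μ) (hμL : μ ≤ L) (hδ : 0 < δ)
    (hdescent : ∀ a ∈ Ω, ∀ b ∈ Ω, h b ≤ h a + ⟪∇ h a, b - a⟫ + L / 2 * ‖b - a‖ ^ 2)
    (hsc : ∀ a ∈ Ω, ∀ b ∈ Ω, h b + ⟪∇ h b, a - b⟫ + μ / 2 * ‖a - b‖ ^ 2 ≤ h a)
    {c : E} (hc : c ∈ Ω) (hmin : ∀ a ∈ Ω, h c ≤ h a) (T : ℕ) {x : E} (hx : x ∈ Ω)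
    (hxδ : h x - h c ≤ δ) :
    ∃ out, cgs lo h L μ δ T x = some out ∧ out.val ∈ Ω ∧
      h out.val - h c ≤ 7 * √(L / μ) * δ * ((2 : ℝ) ^ T)⁻¹ ∧
      (out.fo : ℝ) ≤ T * ⌈√(24 * L / μ)⌉₊ ∧
      (out.lo : ℝ) ≤
        T * (⌈√(24 * L / μ)⌉₊ * (2 * μ * T * 2 ^ T * D ^ 2 / δ + 10)) := by
  have hL : 0 < L := hμ.trans_le hμL
  set M := ⌈√(24 * L / μ)⌉₊ with hM
  set κ := L / μ with hκ
  have hκ1 : 1 ≤ κ := by rw [hκ, le_div_iff₀ hμ]; linarith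
  set ρ := √κ with hρ
  have hρ1 : 1 ≤ ρ := by rw [hρ]; exact Real.one_le_sqrt.2 hκ1
  have hρκ : ρ ^ 2 = κ := Real.sq_sqrt (by linarith)
  have hM4 : 4 * ρ ≤ M := by
    refine le_trans ?_ (Nat.le_ceil _)
    apply Real.le_sqrt_of_sq_le
    have : 24 * L / μ = 24 * κ := by rw [hκ]; ring
    rw [this, mul_pow, hρκ]; linarith
  have hM24 : 24 * κ ≤ (M : ℝ) ^ 2 := by
    have h1 : √(24 * L / μ) ≤ M := Nat.le_ceil _
    have h2 : 24 * L / μ = 24 * κ := by rw [hκ]; ring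
    rw [h2] at h1
    exact (Real.sqrt_le_left (by positivity)).1 h1
  have hMpos : (0 : ℝ) < M := by linarith
  refine Exists.imp ?_ (forLoop_invariant (fun t xbar =>
      (forLoop (cgsInnerStep lo h L μ δ T t) (xbar, xbar) M).map fun s =>
        (⟨s.val.1, s.fo, s.lo⟩ : Counted E))
    -- A stage sends a gap a to at most a/6 + 4ρd with d = δ2⁻ᵗ⁻¹/T. The factor 6 balances the
    -- errors: 12ρd/6 + 4ρd = 6ρd.
    (fun t a => a ∈ Ω ∧ h a - h c ≤ δ * ((2 : ℝ) ^ t)⁻¹ * (1 + 6 * ρ / T))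
    M (M * (2 * μ * T * 2 ^ T * D ^ 2 / δ + 10)) x T ?_ ?_)
  · rintro out ⟨h1, h2, h3, h4⟩
    refine ⟨h1, h2.1, ?_, h3, h4⟩
    -- For T = 0 the quotient 6ρ/T is 0 by convention, and the bound is the initial gap δ.
    rcases T.eq_zero_or_pos with rfl | hT
    · have := h2.2
      simp at this ⊢
      nlinarith
    · have hT' : (1 : ℝ) ≤ T := by exact_mod_cast hT
      have h5 : 6 * ρ / T ≤ 6 * ρ := div_le_self (by linarith) hT'
      calc _ ≤ _ := h2.2
        _ ≤ δ * ((2 : ℝ) ^ T)⁻¹ * (7 * ρ) := by gcongr; linarith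
        _ = _ := by ring
  · refine ⟨hx, ?_⟩
    have : 0 ≤ 6 * ρ / T := by positivity
    simp only [pow_zero, inv_one, mul_one]
    nlinarith
  · rintro t ht a ⟨ha, hgap⟩
    have hT : 0 < T := by omega
    have hT' : (0 : ℝ) < T := by exact_mod_cast hT
    obtain ⟨o, ho, hoΩ, hob, hofo, holo⟩ := cgs_inner_loop hconv hcomp hD hlo hL hμ hδ hdescent
      (fun a ha b hb => by
        have := hsc a ha b hb
        have : 0 ≤ μ / 2 * ‖a - b‖ ^ 2 := by positivity
        linarith) hc hT (t + 1) ha M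
    rw [ho]
    refine ⟨_, rfl, ⟨hoΩ, ?_⟩, hofo, holo.trans ?_⟩
    · have hq := quadratic_growth_of_strongly_convex hconv hμ hsc hc hmin ha
      set a0 := h a - h c with ha0
      set a1 := h o.val.1 - h c with ha1
      have ha1n : 0 ≤ a1 := by have := hmin _ hoΩ; linarith
      set d := δ * ((2 : ℝ) ^ (t + 1))⁻¹ / T with hd
      have hd0 : 0 < d := by positivity
      have e1 : 8 * L * δ * ((2 : ℝ) ^ (t + 1))⁻¹ / (μ * T) = 8 * κ * d := by
        rw [hd, hκ]; field_simp
      rw [e1] at hob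
      have h6 : L * ‖a - c‖ ^ 2 ≤ 2 * κ * a0 := by
        have : L * ‖a - c‖ ^ 2 = 2 * κ * (μ / 2 * ‖a - c‖ ^ 2) := by rw [hκ]; field_simp
        rw [this]
        exact mul_le_mul_of_nonneg_left (by linarith) (by linarith)
      have h7 : a1 ≤ a0 / 6 + 4 * ρ * d := by
        have i1 : (M : ℝ) * M / 2 * a1 ≤ 2 * κ * a0 + M * (8 * κ * d) := by
          have : (M : ℝ) * M / 2 * a1 ≤ M * (M + 1) / 2 * a1 := by gcongr; linarith
          linarith
        have i2 : (M : ℝ) * (8 * κ * d) ≤ M * M / 2 * (4 * ρ * d) := by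
          have : (M : ℝ) * M / 2 * (4 * ρ * d) = M * (2 * ρ * d) * M := by ring
          rw [this]
          calc (M : ℝ) * (8 * κ * d) = M * (2 * ρ * d) * (4 * ρ) := by rw [← hρκ]; ring
            _ ≤ _ := by gcongr
        have ha0n : 0 ≤ a0 := by have := hmin _ ha; linarith
        have i3 : 2 * κ * a0 ≤ M * M / 2 * (a0 / 6) := by nlinarith
        have i4 : (M : ℝ) * M / 2 * a1 ≤ M * M / 2 * (a0 / 6 + 4 * ρ * d) := by linarith
        exact le_of_mul_le_mul_left i4 (by positivity)
      have e2 : δ * ((2 : ℝ) ^ t)⁻¹ * (1 + 6 * ρ / T) =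
          2 * (δ * ((2 : ℝ) ^ (t + 1))⁻¹) + 12 * ρ * d := by
        rw [hd, pow_succ]; field_simp; ring
      have e3 : δ * ((2 : ℝ) ^ (t + 1))⁻¹ * (1 + 6 * ρ / T) =
          δ * ((2 : ℝ) ^ (t + 1))⁻¹ + 6 * ρ * d := by
        rw [hd]; field_simp
      rw [e3]
      rw [e2] at hgap
      have : 0 < δ * ((2 : ℝ) ^ (t + 1))⁻¹ := by positivity
      linarith
    · have : (2 : ℝ) ^ (t + 1) ≤ 2 ^ T := pow_le_pow_right₀ (by norm_num) (by omega)
      gcongr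

end Sliding

/-! ### Regularity of the objective and of its maximizers in y -/

section Objective

variable {E : Type*} [NormedAddCommGroup E] [InnerProductSpace ℝ E] [CompleteSpace E]
variable {F : Type*} [NormedAddCommGroup F] [InnerProductSpace ℝ F] [CompleteSpace F]
variable {f : E → F → ℝ} {X : Set E} {Y : Set F} {L μ : ℝ}

namespace IsConvexStronglyConcave

theorem hasGradientAt_gradX (hf : IsConvexStronglyConcave f X Y L μ) {x : E} (hx : x ∈ X)
    {y : F} (hy : y ∈ Y) : HasGradientAt (fun x' => f x' y) (gradX f x y) x := by
  have h : DifferentiableAt ℝ (fun x' : E => (x', y)) x := by fun_prop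
  exact ((hf.differentiable x hx y hy).comp x h).hasGradientAt

theorem hasGradientAt_gradY (hf : IsConvexStronglyConcave f X Y L μ) {x : E} (hx : x ∈ X)
    {y : F} (hy : y ∈ Y) : HasGradientAt (fun y' => f x y') (gradY f x y) y := by
  have h : DifferentiableAt ℝ (fun y' : F => (x, y')) y := by fun_prop
  exact ((hf.differentiable x hx y hy).comp y h).hasGradientAt

theorem hasGradientAt_neg (hf : IsConvexStronglyConcave f X Y L μ) {x : E} (hx : x ∈ X)
    {y : F} (hy : y ∈ Y) : HasGradientAt (fun y' => -f x y') (-gradY f x y) y := by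
  have h := (hf.hasGradientAt_gradY hx hy).hasFDerivAt.fun_neg
  rw [hasGradientAt_iff_hasFDerivAt, map_neg]
  exact h

/-- Splits smoothness of the full gradient into Lipschitz bounds for its two blocks, with the same
constant. -/
theorem le_mul_of_sq_add_sq_le {a b c L : ℝ} (hL : 0 < L) (hc : 0 ≤ c)
    (h : a ^ 2 + b ^ 2 ≤ L ^ 2 * c ^ 2) : a ≤ L * c ∧ b ≤ L * c := by
  have h0 : 0 ≤ L * c := by positivity
  constructor <;> refine abs_le_of_sq_le_sq' ?_ h0 |>.2 <;> nlinarith [sq_nonneg a, sq_nonneg b]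

theorem gradX_lipschitz_left (hf : IsConvexStronglyConcave f X Y L μ) {y : F} (hy : y ∈ Y)
    {a b : E} (ha : a ∈ X) (hb : b ∈ X) : ‖gradX f a y - gradX f b y‖ ≤ L * ‖a - b‖ :=
  (le_mul_of_sq_add_sq_le hf.L_pos (norm_nonneg _)
    (by simpa using hf.smooth a ha y hy b hb y hy)).1

theorem gradX_lipschitz_right (hf : IsConvexStronglyConcave f X Y L μ) {x : E} (hx : x ∈ X)
    {a b : F} (ha : a ∈ Y) (hb : b ∈ Y) : ‖gradX f x a - gradX f x b‖ ≤ L * ‖a - b‖ :=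
  (le_mul_of_sq_add_sq_le hf.L_pos (norm_nonneg _)
    (by simpa using hf.smooth x hx a ha x hx b hb)).1

theorem gradY_lipschitz_left (hf : IsConvexStronglyConcave f X Y L μ) {y : F} (hy : y ∈ Y)
    {a b : E} (ha : a ∈ X) (hb : b ∈ X) : ‖gradY f a y - gradY f b y‖ ≤ L * ‖a - b‖ :=
  (le_mul_of_sq_add_sq_le hf.L_pos (norm_nonneg _)
    (by simpa using hf.smooth a ha y hy b hb y hy)).2

theorem gradY_lipschitz_right (hf : IsConvexStronglyConcave f X Y L μ) {x : E} (hx : x ∈ X)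
    {a b : F} (ha : a ∈ Y) (hb : b ∈ Y) : ‖gradY f x a - gradY f x b‖ ≤ L * ‖a - b‖ :=
  (le_mul_of_sq_add_sq_le hf.L_pos (norm_nonneg _)
    (by simpa using hf.smooth x hx a ha x hx b hb)).2

theorem descent_X (hf : IsConvexStronglyConcave f X Y L μ) {y : F} (hy : y ∈ Y)
    {a b : E} (ha : a ∈ X) (hb : b ∈ X) :
    f b y ≤ f a y + ⟪gradX f a y, b - a⟫ + L / 2 * ‖b - a‖ ^ 2 :=
  descent_of_lipschitz_gradient hf.convex_X (h := fun x => f x y) (g := fun x => gradX f x y)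
    (fun _ hz => hf.hasGradientAt_gradX hz hy)
    (fun _ ha _ hb => hf.gradX_lipschitz_left hy ha hb) ha hb

theorem descent_neg_Y (hf : IsConvexStronglyConcave f X Y L μ) {x : E} (hx : x ∈ X)
    {a b : F} (ha : a ∈ Y) (hb : b ∈ Y) :
    -f x b ≤ -f x a + ⟪∇ (fun y => -f x y) a, b - a⟫ + L / 2 * ‖b - a‖ ^ 2 := by
  rw [(hf.hasGradientAt_neg hx ha).gradient]
  refine descent_of_lipschitz_gradient hf.convex_Y (h := fun y => -f x y)
    (g := fun y => -gradY f x y) (fun _ hz => hf.hasGradientAt_neg hx hz) ?_ ha hb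
  intro a ha b hb
  rw [← neg_sub', norm_neg]
  exact hf.gradY_lipschitz_right hx ha hb

theorem strongly_convex_neg_Y (hf : IsConvexStronglyConcave f X Y L μ) {x : E} (hx : x ∈ X)
    {a b : F} (ha : a ∈ Y) (hb : b ∈ Y) :
    -f x b + ⟪∇ (fun y => -f x y) b, a - b⟫ + μ / 2 * ‖a - b‖ ^ 2 ≤ -f x a := by
  rw [(hf.hasGradientAt_neg hx hb).gradient, inner_neg_left]
  linarith [hf.strongly_concave x hx a ha b hb]

/-- Between two distinct points of Y the quadratic upper and lower models of -f(x,·) must be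
compatible. This gives κ ≥ 1, used throughout. -/
theorem mu_le_L (hf : IsConvexStronglyConcave f X Y L μ) (hX : X.Nonempty)
    (hY : Y.Nontrivial) : μ ≤ L := by
  obtain ⟨x, hx⟩ := hX
  obtain ⟨a, ha, b, hb, hab⟩ := hY
  have h1 := hf.descent_neg_Y hx ha hb
  have h2 := hf.strongly_convex_neg_Y hx hb ha
  have h3 : 0 < ‖b - a‖ ^ 2 := by
    have := norm_pos_iff.2 (sub_ne_zero.2 hab.symm)
    positivity
  have h4 : μ * ‖b - a‖ ^ 2 ≤ L * ‖b - a‖ ^ 2 := by linarith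
  exact le_of_mul_le_mul_right h4 h3

theorem continuousOn_Y (hf : IsConvexStronglyConcave f X Y L μ) {x : E} (hx : x ∈ X) :
    ContinuousOn (fun y => f x y) Y := fun _ hy =>
  (hf.hasGradientAt_gradY hx hy).continuousAt.continuousWithinAt

theorem continuousOn_X (hf : IsConvexStronglyConcave f X Y L μ) {y : F} (hy : y ∈ Y) :
    ContinuousOn (fun x => f x y) X := fun _ hx =>
  (hf.hasGradientAt_gradX hx hy).continuousAt.continuousWithinAt

theorem exists_argmax (hf : IsConvexStronglyConcave f X Y L μ) (hY : Y.Nonempty)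
    {x : E} (hx : x ∈ X) : ∃ y ∈ Y, ∀ y' ∈ Y, f x y' ≤ f x y :=
  hf.compact_Y.exists_isMaxOn hY (hf.continuousOn_Y hx)

theorem growth_Y (hf : IsConvexStronglyConcave f X Y L μ) {x : E} (hx : x ∈ X) {c : F}
    (hc : c ∈ Y) (hmax : ∀ y' ∈ Y, f x y' ≤ f x c) {y : F} (hy : y ∈ Y) :
    f x y + μ / 2 * ‖y - c‖ ^ 2 ≤ f x c := by
  have := quadratic_growth_of_strongly_convex hf.convex_Y hf.mu_pos (h := fun y => -f x y)
    (fun a ha b hb => hf.strongly_convex_neg_Y hx ha hb) hc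
    (fun a ha => neg_le_neg (hmax a ha)) hy
  linarith

/-- The mixed second difference of `f` is at most `L ‖a - b‖ ‖c - d‖`. -/
theorem mixed_difference_le (hf : IsConvexStronglyConcave f X Y L μ) {a b : E} (ha : a ∈ X)
    (hb : b ∈ X) {c d : F} (hc : c ∈ Y) (hd : d ∈ Y) :
    f a c - f a d ≤ f b c - f b d + L * ‖a - b‖ * ‖c - d‖ := by
  -- Mean value inequality for y ↦ f(a,y) - f(b,y), whose gradient has norm at most L‖a - b‖.
  have h := hf.convex_Y.norm_image_sub_le_of_norm_hasFDerivWithin_le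
    (f := fun y => f a y - f b y) (C := L * ‖a - b‖)
    (fun y hy => ((hf.hasGradientAt_gradY ha hy).hasFDerivAt.sub
      (hf.hasGradientAt_gradY hb hy).hasFDerivAt).hasFDerivWithinAt)
    (fun y hy => by
      rw [← map_sub, LinearIsometryEquiv.norm_map]
      exact hf.gradY_lipschitz_left hy ha hb) hd hc
  have := le_of_abs_le (Real.norm_eq_abs _ ▸ h)
  linarith

/-- Adding quadratic growth at both maximizers gives μ‖c - d‖² on one side and a mixed second
difference, linear in ‖c - d‖, on the other. -/
theorem argmax_lipschitz (hf : IsConvexStronglyConcave f X Y L μ) {a b : E} (ha : a ∈ X)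
    (hb : b ∈ X) {c d : F} (hc : c ∈ Y) (hd : d ∈ Y) (hca : ∀ y' ∈ Y, f a y' ≤ f a c)
    (hdb : ∀ y' ∈ Y, f b y' ≤ f b d) : ‖c - d‖ ≤ L / μ * ‖a - b‖ := by
  have h1 := hf.growth_Y ha hc hca hd
  have h2 := hf.growth_Y hb hd hdb hc
  have h3 := hf.mixed_difference_le ha hb hc hd
  rw [norm_sub_rev d c] at h1
  have h4 : μ * ‖c - d‖ * ‖c - d‖ ≤ L * ‖a - b‖ * ‖c - d‖ := by nlinarith
  rw [div_mul_eq_mul_div, le_div_iff₀ hf.mu_pos]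
  rcases (norm_nonneg (c - d)).eq_or_lt with h0 | h0
  · rw [← h0, zero_mul]
    exact mul_nonneg hf.L_pos.le (norm_nonneg _)
  · rw [mul_comm]
    exact le_of_mul_le_mul_right h4 h0

theorem dist_argmax_le (hf : IsConvexStronglyConcave f X Y L μ) {x : E} (hx : x ∈ X) {c : F}
    (hc : c ∈ Y) (hmax : ∀ y' ∈ Y, f x y' ≤ f x c) {y : F} (hy : y ∈ Y) {e : ℝ}
    (hye : ∀ y' ∈ Y, f x y' - e ≤ f x y) : ‖y - c‖ ≤ √(2 * e / μ) := by
  have h1 := hf.growth_Y hx hc hmax hy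
  have h2 := hye c hc
  apply Real.le_sqrt_of_sq_le
  rw [le_div_iff₀ hf.mu_pos]
  linarith

theorem dist_near_argmax_le (hf : IsConvexStronglyConcave f X Y L μ) {a b : E} (ha : a ∈ X)
    (hb : b ∈ X) {c d : F} (hc : c ∈ Y) (hd : d ∈ Y) {e : ℝ}
    (hca : ∀ y' ∈ Y, f a y' - e ≤ f a c) (hdb : ∀ y' ∈ Y, f b y' - e ≤ f b d) :
    ‖c - d‖ ≤ L / μ * ‖a - b‖ + 2 * √(2 * e / μ) := by
  obtain ⟨c', hc', hc'm⟩ := hf.exists_argmax ⟨c, hc⟩ ha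
  obtain ⟨d', hd', hd'm⟩ := hf.exists_argmax ⟨c, hc⟩ hb
  have h1 := hf.dist_argmax_le ha hc' hc'm hc hca
  have h2 := hf.dist_argmax_le hb hd' hd'm hd hdb
  have h3 := hf.argmax_lipschitz ha hb hc' hd' hc'm hd'm
  have h4 : c - d = (c - c') + (c' - d') + (d' - d) := by abel
  have h5 := norm_add₃_le (a := c - c') (b := c' - d') (c := d' - d)
  rw [← h4, norm_sub_rev d' d] at h5
  linarith

/-- A near maximizer of `f b` is a near maximizer of `f a`, if `a` is close to `b`. -/
theorem near_argmax_transfer (hf : IsConvexStronglyConcave f X Y L μ) {a b : E} (ha : a ∈ X)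
    (hb : b ∈ X) {y : F} (hy : y ∈ Y) {e : ℝ} (he : 0 ≤ e)
    (hyb : ∀ y' ∈ Y, f b y' - e ≤ f b y) {y' : F} (hy' : y' ∈ Y) :
    f a y' - f a y ≤ 2 * e + 3 / 2 * (L / μ * L * ‖a - b‖ ^ 2) := by
  obtain ⟨c, hc, hcm⟩ := hf.exists_argmax ⟨y, hy⟩ ha
  obtain ⟨d, hd, hdm⟩ := hf.exists_argmax ⟨y, hy⟩ hb
  have h1 := hcm y' hy'
  have h2 := hf.mixed_difference_le ha hb hc hy
  have h3 := hyb c hc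
  have h4 := hf.dist_argmax_le hb hd hdm hy hyb
  have h5 := hf.argmax_lipschitz ha hb hc hd hcm hdm
  have h6 : ‖c - y‖ ≤ L / μ * ‖a - b‖ + √(2 * e / μ) := by
    have := norm_add_le (c - d) (d - y)
    rw [sub_add_sub_cancel, norm_sub_rev d y] at this
    linarith
  have hμ := hf.mu_pos
  have hL := hf.L_pos
  have h7 : L * ‖a - b‖ * ‖c - y‖ ≤ L * ‖a - b‖ * (L / μ * ‖a - b‖ + √(2 * e / μ)) :=
    mul_le_mul_of_nonneg_left h6 (by positivity)
  set q := √(2 * e / μ) with hq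
  have hq2 : μ * q ^ 2 = 2 * e := by rw [hq, Real.sq_sqrt (by positivity)]; field_simp
  -- Young's inequality with weight μ; since μq² = 2e, the cross term costs one more e and half of
  -- κL‖a - b‖².
  have h8 : L * ‖a - b‖ * q ≤ 1 / 2 * (L / μ * L * ‖a - b‖ ^ 2) + 1 / 2 * (μ * q ^ 2) := by
    have : 0 ≤ (L * ‖a - b‖ - μ * q) ^ 2 / (2 * μ) := by positivity
    have e1 : (L * ‖a - b‖ - μ * q) ^ 2 / (2 * μ) = 1 / 2 * (L / μ * L * ‖a - b‖ ^ 2)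
        + 1 / 2 * (μ * q ^ 2) - L * ‖a - b‖ * q := by field_simp; ring
    linarith
  have e2 : L * ‖a - b‖ * (L / μ * ‖a - b‖ + q) =
      L / μ * L * ‖a - b‖ ^ 2 + L * ‖a - b‖ * q := by ring
  linarith

end IsConvexStronglyConcave

end Objective

/-! ### Prox-step: an inexact fixed point iteration -/

section ProxStep

variable {E : Type*} [NormedAddCommGroup E] [InnerProductSpace ℝ E] [CompleteSpace E]
variable {F : Type*} [NormedAddCommGroup F] [InnerProductSpace ℝ F] [CompleteSpace F]
variable {f : E → F → ℝ} {X : Set E} {Y : Set F} {L μ : ℝ}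

/-- The number of outer iterations of CGS. -/
noncomputable def outerIterations (κ δ e : ℝ) : ℕ := ⌈Real.logb 2 (7 * √κ * δ / e)⌉₊

/-- CGS reaches the accuracy `e`, with bounds on its cost that hold for all `δ ≤ Δ`. -/
theorem cgs_outerIterations_spec (hf : IsConvexStronglyConcave f X Y L μ) (hμL : μ ≤ L)
    {D : ℝ} (hD : ∀ a ∈ Y, ∀ b ∈ Y, ‖a - b‖ ≤ D) {lo : F → F} (hlo : IsLinOracle Y lo)
    {x : E} (hx : x ∈ X) {y₀ : F} (hy₀ : y₀ ∈ Y) {δ Δ e : ℝ} (hδ : 0 < δ) (hδΔ : δ ≤ Δ)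
    (he : 0 < e) (hgap : ∀ y' ∈ Y, f x y' - f x y₀ ≤ δ) :
    ∃ out, cgs lo (fun y => -f x y) L μ δ (outerIterations (L / μ) δ e) y₀ = some out ∧
      out.val ∈ Y ∧ (∀ y' ∈ Y, f x y' - e ≤ f x out.val) ∧
      (out.fo : ℝ) ≤ outerIterations (L / μ) Δ e * ⌈√(24 * L / μ)⌉₊ ∧
      (out.lo : ℝ) ≤ outerIterations (L / μ) Δ e * (⌈√(24 * L / μ)⌉₊ *
        (28 * μ * outerIterations (L / μ) Δ e * √(L / μ) * D ^ 2 / e + 10)) := by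
  have hμ := hf.mu_pos
  have hL := hf.L_pos
  obtain ⟨c, hc, hcm⟩ := hf.exists_argmax ⟨y₀, hy₀⟩ hx
  obtain ⟨o, h1, h2, h3, h4, h5⟩ := cgs_spec hf.convex_Y hf.compact_Y hD hlo
    (h := fun y => -f x y) hμ hμL hδ
    (fun a ha b hb => hf.descent_neg_Y hx ha hb)
    (fun a ha b hb => hf.strongly_convex_neg_Y hx ha hb) hc
    (fun a ha => neg_le_neg (hcm a ha)) (outerIterations (L / μ) δ e) hy₀
    (by linarith [hgap c hc])
  set T := outerIterations (L / μ) δ e with hT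
  set T' := outerIterations (L / μ) Δ e with hT'
  have hρ : 0 < √(L / μ) := Real.sqrt_pos.2 (by positivity)
  set B := 7 * √(L / μ) * δ / e with hB
  have hBpos : 0 < B := by positivity
  have hTT' : (T : ℝ) ≤ T' := by
    have : T ≤ T' := Nat.ceil_mono (Real.logb_le_logb_of_le (by norm_num) hBpos (by gcongr))
    exact_mod_cast this
  have hpow : B ≤ 2 ^ T := by
    have : Real.logb 2 B ≤ T := Nat.le_ceil _
    rw [Real.logb_le_iff_le_rpow (by norm_num) hBpos, Real.rpow_natCast] at this
    exact this
  refine ⟨o, h1, h2, ?_, h4.trans (by gcongr), ?_⟩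
  · intro y' hy'
    have h6 : 7 * √(L / μ) * δ * ((2 : ℝ) ^ T)⁻¹ ≤ e := by
      rw [← div_eq_mul_inv, div_le_iff₀ (by positivity)]
      rw [hB, div_le_iff₀ he] at hpow
      linarith
    linarith [hcm y' hy']
  -- For T = 0 no call is made. For T > 0 the logarithm is positive, so rounding up at most doubles
  -- the power: 2ᵀ ≤ 2B. The δ inside B then cancels, so Δ enters the cost only through a logarithm.
  · rcases T.eq_zero_or_pos with h0 | h0
    · rw [h0] at h5
      simp only [Nat.cast_zero, zero_mul] at h5
      exact h5.trans (by positivity)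
    · have hpow' : (2 : ℝ) ^ T ≤ 2 * B := by
        have hlog : 0 < Real.logb 2 B := Nat.ceil_pos.1 h0
        have : (T : ℝ) < Real.logb 2 B + 1 := Nat.ceil_lt_add_one hlog.le
        rw [← sub_lt_iff_lt_add, Real.lt_logb_iff_rpow_lt (by norm_num) hBpos,
          Real.rpow_sub (by norm_num), Real.rpow_natCast, Real.rpow_one,
          div_lt_iff₀ (by norm_num)] at this
        linarith
      refine h5.trans ?_
      have h6 : 2 * μ * T * 2 ^ T * D ^ 2 / δ ≤ 28 * μ * T' * √(L / μ) * D ^ 2 / e := by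
        calc 2 * μ * T * 2 ^ T * D ^ 2 / δ ≤ 2 * μ * T' * (2 * B) * D ^ 2 / δ := by gcongr
          _ = _ := by rw [hB]; field_simp; ring
      gcongr

/-- The fixed point iteration of Prox-step contracts by `1 / 2`, up to the errors. -/
theorem proxAccuracy_contraction {γ α ζ e d : ℝ} (hμ : 0 < μ) (hL : 0 < L) (hγ : 0 < γ)
    (hα : 0 < α) (hζ : 0 < ζ) (he : 0 < e) (hd : 0 ≤ d) (hγα : 2 * (L / μ * L * γ) ≤ α) :
    γ * (L * (L / μ * d + 2 * √(2 * e / μ)) / α + √(2 * ζ / α)) ≤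
      d / 2 + 3 / 4 * proxAccuracy L μ γ α ζ e := by
  rw [proxAccuracy]
  set S := √(2 * (L / μ) * L * e / α ^ 2 + 2 * ζ / α) with hS
  have h1 : √(2 * ζ / α) ≤ S := Real.sqrt_le_sqrt (by
    have : 0 ≤ 2 * (L / μ) * L * e / α ^ 2 := by positivity
    linarith)
  have h2 : L * √(2 * e / μ) / α ≤ S := by
    apply Real.le_sqrt_of_sq_le
    rw [div_pow, mul_pow, Real.sq_sqrt (by positivity)]
    have e1 : L ^ 2 * (2 * e / μ) / α ^ 2 = 2 * (L / μ) * L * e / α ^ 2 := by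
      field_simp
    have : 0 ≤ 2 * ζ / α := by positivity
    linarith
  have h3 : γ * (L * (L / μ * d)) / α ≤ d / 2 := by
    rw [div_le_iff₀ hα]
    nlinarith
  have e2 : γ * (L * (L / μ * d + 2 * √(2 * e / μ)) / α + √(2 * ζ / α)) =
      γ * (L * (L / μ * d)) / α + γ * (2 * (L * √(2 * e / μ) / α) + √(2 * ζ / α)) := by
    ring
  rw [e2]
  have h4 : γ * (2 * (L * √(2 * e / μ) / α) + √(2 * ζ / α)) ≤ γ * (3 * S) :=
    mul_le_mul_of_nonneg_left (by linarith) hγ.le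
  linarith

/-- One iteration of Prox-step. -/
theorem proxIter_spec (hf : IsConvexStronglyConcave f X Y L μ)
    {DX : ℝ} (hDX : ∀ a ∈ X, ∀ b ∈ X, ‖a - b‖ ≤ DX)
    {loX : E → E} (hloX : IsLinOracle X loX) (loY : F → F)
    (δ₀ : E → F → ℝ) (inner : ℝ → ℝ → ℝ → ℕ) {x₀ v₀ z : E} (hx₀ : x₀ ∈ X) (hv₀ : v₀ ∈ X)
    {y₀ : F} {γ α ζ e A B : ℝ} (hγ : 0 < γ) (hγ1 : γ ≤ 1) (hα : 0 < α) (hζ : 0 < ζ)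
    (hcgs : ∀ x ∈ X, ∃ out, cgs loY (fun y => -f x y) L μ (δ₀ x y₀)
      (inner (L / μ) (δ₀ x y₀) e) y₀ = some out ∧ out.val ∈ Y ∧
      (∀ y' ∈ Y, f x y' - e ≤ f x out.val) ∧ (out.fo : ℝ) ≤ A ∧ (out.lo : ℝ) ≤ B)
    {s : E × F × E} (hs : s.1 ∈ X) :
    ∃ out, proxIter loX loY Y f L μ δ₀ inner x₀ y₀ z v₀ γ α ζ e s = some out ∧
      out.val.1 ∈ X ∧ out.val.2.1 ∈ Y ∧ out.val.2.2 ∈ X ∧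
      out.val.1 = (1 - γ) • x₀ + γ • out.val.2.2 ∧
      (∀ y' ∈ Y, f s.1 y' - e ≤ f s.1 out.val.2.1) ∧
      (∀ u ∈ X, ⟪gradX f z out.val.2.1 + α • (out.val.2.2 - v₀), out.val.2.2 - u⟫ ≤ ζ) ∧
      (out.fo : ℝ) ≤ A + 1 ∧ (out.lo : ℝ) ≤ B + (8 * (α * DX ^ 2) / ζ + 10) := by
  obtain ⟨y, hy, hyY, hyem, hyfo, hylo⟩ := hcgs s.1 hs
  obtain ⟨u, hu, huX, hugap, hufo, hulo⟩ := cndg_spec hf.convex_X hf.compact_X hDX hloX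
    (gradX f z y.val) hv₀ hα hζ
  refine ⟨⟨((1 - γ) • x₀ + γ • u.val, y.val, u.val), y.fo + u.fo + 1, y.lo + u.lo⟩, ?_,
    hf.convex_X hx₀ huX (by linarith) hγ.le (by ring), hyY, huX, rfl, hyem, hugap, ?_, ?_⟩
  · rw [proxIter, hy, Option.bind_some, if_pos hyem, hu, Option.map_some]
  · push_cast; rw [hufo]; push_cast; linarith
  · push_cast; linarith

/-- Prox-step delivers an approximate solution of the prox-subproblem. -/
theorem proxStep_spec (hf : IsConvexStronglyConcave f X Y L μ)
    (hDX : ∀ a ∈ X, ∀ b ∈ X, ‖a - b‖ ≤ Metric.diam X)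
    {loX : E → E} (hloX : IsLinOracle X loX) (loY : F → F)
    (δ₀ : E → F → ℝ) (inner : ℝ → ℝ → ℝ → ℕ) {x₀ v₀ z : E} (hx₀ : x₀ ∈ X) (hv₀ : v₀ ∈ X)
    (hz : z ∈ X) {y₀ : F} {γ α ζ ε e A B : ℝ} (hγ : 0 < γ) (hγ1 : γ ≤ 1)
    (hα : 0 < α) (hζ : 0 < ζ) (he : 0 < e) (hee : ε / (64 * (L / μ)) = e)
    (hγα : 2 * (L / μ * L * γ) ≤ α)
    (hR : proxAccuracy L μ γ α ζ e < 4 * Metric.diam X)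
    (hcgs : ∀ x ∈ X, ∃ out, cgs loY (fun y => -f x y) L μ (δ₀ x y₀)
      (inner (L / μ) (δ₀ x y₀) e) y₀ = some out ∧ out.val ∈ Y ∧
      (∀ y' ∈ Y, f x y' - e ≤ f x out.val) ∧ (out.fo : ℝ) ≤ A ∧ (out.lo : ℝ) ≤ B) :
    ∃ out, proxStep loX loY X Y f L μ δ₀ inner x₀ y₀ z v₀ γ α ζ ε = some out ∧
      out.val.1 ∈ X ∧ out.val.2.1 ∈ Y ∧ out.val.2.2 ∈ X ∧
      out.val.1 = (1 - γ) • x₀ + γ • out.val.2.2 ∧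
      (∀ u ∈ X, ⟪gradX f z out.val.2.1 + α • (out.val.2.2 - v₀), out.val.2.2 - u⟫ ≤ ζ) ∧
      (∀ y' ∈ Y, f out.val.1 y' - f out.val.1 out.val.2.1 ≤
        2 * e + 6 * (L / μ * L * proxAccuracy L μ γ α ζ e ^ 2)) ∧
      (out.fo : ℝ) ≤ ⌈Real.logb 2 (4 * Metric.diam X / proxAccuracy L μ γ α ζ e)⌉₊ * (A + 1) ∧
      (out.lo : ℝ) ≤ ⌈Real.logb 2 (4 * Metric.diam X / proxAccuracy L μ γ α ζ e)⌉₊ *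
        (B + (8 * (α * Metric.diam X ^ 2) / ζ + 10)) := by
  have hμ := hf.mu_pos
  have hL := hf.L_pos
  set D := Metric.diam X with hD
  set ρ := proxAccuracy L μ γ α ζ e with hρ
  have hρ0 : 0 < ρ := by rw [hρ, proxAccuracy]; positivity
  simp only [proxStep, hee]
  rw [← hρ]
  set R := ⌈Real.logb 2 (4 * D / ρ)⌉₊ with hRdef
  refine Exists.imp ?_ (forLoop_invariant
    (fun _ s => proxIter loX loY Y f L μ δ₀ inner x₀ y₀ z v₀ γ α ζ e s)
    -- The initial triple satisfies no optimality relation, hence the guard 0 < r. The point x' is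
    -- the previous iterate, at which the current y is nearly maximal; halving with error 3ρ/4
    -- leaves the offset 3ρ/2.
    (fun r s => s.1 ∈ X ∧ (0 < r → s.2.1 ∈ Y ∧ s.2.2 ∈ X ∧ s.1 = (1 - γ) • x₀ + γ • s.2.2 ∧
      (∀ u ∈ X, ⟪gradX f z s.2.1 + α • (s.2.2 - v₀), s.2.2 - u⟫ ≤ ζ) ∧
      ∃ x' ∈ X, (∀ y' ∈ Y, f x' y' - e ≤ f x' s.2.1) ∧
        ‖s.1 - x'‖ ≤ D * 2 * ((2 : ℝ) ^ r)⁻¹ + 3 / 2 * ρ))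
    (A + 1) (B + (8 * (α * D ^ 2) / ζ + 10)) (x₀, y₀, v₀) R ⟨hx₀, fun h => absurd h (by simp)⟩ ?_)
  · rintro out ⟨h1, ⟨h2, h3⟩, h4, h5⟩
    -- At least one round must run, or the guarded part of the invariant would say nothing.
    have h4D : 1 < 4 * D / ρ := by rwa [one_lt_div hρ0]
    have hRpos : 0 < R := Nat.ceil_pos.2 (Real.logb_pos (by norm_num) h4D)
    obtain ⟨hy, hv, hx, hgap, x', hx', hem, hdist⟩ := h3 hRpos
    refine ⟨h1, h2, hy, hv, hx, hgap, fun y' hy' => ?_, h4, h5⟩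
    have hpow : 4 * D / ρ ≤ 2 ^ R := by
      have : Real.logb 2 (4 * D / ρ) ≤ R := Nat.le_ceil _
      rwa [Real.logb_le_iff_le_rpow (by norm_num) (by linarith), Real.rpow_natCast] at this
    have h6 : D * 2 * ((2 : ℝ) ^ R)⁻¹ ≤ ρ / 2 := by
      rw [← div_eq_mul_inv, div_le_iff₀ (by positivity)]
      rw [div_le_iff₀ hρ0] at hpow
      linarith
    have h7 := hf.near_argmax_transfer h2 hx' hy he.le hem hy'
    have h8 : ‖out.val.1 - x'‖ ^ 2 ≤ (2 * ρ) ^ 2 :=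
      pow_le_pow_left₀ (norm_nonneg _) (by linarith) 2
    have h9 : L / μ * L * ‖out.val.1 - x'‖ ^ 2 ≤ L / μ * L * (2 * ρ) ^ 2 :=
      mul_le_mul_of_nonneg_left h8 (by positivity)
    linarith
  · rintro r - s ⟨hs, hpos⟩
    obtain ⟨o, ho, hox, hoy, hov, hoeq, hoem, hogap, hofo, holo⟩ :=
      proxIter_spec hf hDX hloX loY δ₀ inner (z := z) hx₀ hv₀ hγ hγ1 hα hζ hcgs hs
    refine ⟨o, ho, ⟨hox, fun _ => ⟨hoy, hov, hoeq, hogap, s.1, hs, hoem, ?_⟩⟩, hofo, holo⟩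
    rcases r.eq_zero_or_pos with rfl | hr
    · have := hDX _ hox _ hs
      simp only [zero_add, pow_one]
      linarith
    · obtain ⟨hy, hv, hx, hgap, x', hx', hem, hdist⟩ := hpos hr
      have h1 := prox_dist_le hα hζ.le (hgap _ hov) (hogap _ hv)
      have h2 := hf.gradX_lipschitz_right hz hoy hy
      have h3 := hf.dist_near_argmax_le hs hx' hoy hy hoem hem
      have h4 : ‖o.val.1 - s.1‖ = γ * ‖o.val.2.2 - s.2.2‖ := by
        rw [hoeq]
        nth_rewrite 1 [hx]
        rw [add_sub_add_left_eq_sub, ← smul_sub, norm_smul, Real.norm_eq_abs, abs_of_pos hγ]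
      have h5 := proxAccuracy_contraction (d := ‖s.1 - x'‖) hμ hL hγ hα hζ he (norm_nonneg _) hγα
      have h6 : ‖o.val.2.2 - s.2.2‖ ≤
          L * (L / μ * ‖s.1 - x'‖ + 2 * √(2 * e / μ)) / α + √(2 * ζ / α) := by
        refine h1.trans ?_
        gcongr
        exact h2.trans (mul_le_mul_of_nonneg_left h3 hL.le)
      have h7 := mul_le_mul_of_nonneg_left h6 hγ.le
      have h8 : D * 2 * ((2 : ℝ) ^ (r + 1))⁻¹ = D * 2 * ((2 : ℝ) ^ r)⁻¹ / 2 := by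
        rw [pow_succ, mul_inv]; ring
      rw [h4, h8]
      linarith

end ProxStep

/-! ### Mirror-Prox: parameters, invariant and convergence -/

section MirrorProx

variable {E : Type*} [NormedAddCommGroup E] [InnerProductSpace ℝ E] [CompleteSpace E]
variable {F : Type*} [NormedAddCommGroup F] [InnerProductSpace ℝ F] [CompleteSpace F]
variable {f : E → F → ℝ} {X : Set E} {Y : Set F} {L μ : ℝ}

theorem IsConvexStronglyConcave.concave_Y (hf : IsConvexStronglyConcave f X Y L μ) {x : E}
    (hx : x ∈ X) {a b : F} (ha : a ∈ Y) (hb : b ∈ Y) {t : ℝ} (ht0 : 0 ≤ t) (ht1 : t ≤ 1) :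
    (1 - t) * f x a + t * f x b ≤ f x ((1 - t) • a + t • b) := by
  set z := (1 - t) • a + t • b with hz
  have hzY : z ∈ Y := hf.convex_Y ha hb (by linarith) ht0 (by ring)
  have h1 := hf.strongly_concave x hx a ha z hzY
  have h2 := hf.strongly_concave x hx b hb z hzY
  have hμ := hf.mu_pos
  have n1 : 0 ≤ μ / 2 * ‖a - z‖ ^ 2 := by positivity
  have n2 : 0 ≤ μ / 2 * ‖b - z‖ ^ 2 := by positivity
  have h3 : (1 - t) * ⟪gradY f x z, a - z⟫ + t * ⟪gradY f x z, b - z⟫ = 0 := by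
    rw [← inner_smul_right, ← inner_smul_right, ← inner_add_right]
    have : (1 - t) • (a - z) + t • (b - z) = 0 := by rw [hz]; module
    rw [this, inner_zero_right]
  have h4 : (1 - t) * (f x a - f x z) ≤ (1 - t) * ⟪gradY f x z, a - z⟫ :=
    mul_le_mul_of_nonneg_left (by linarith) (by linarith)
  have h5 : t * (f x b - f x z) ≤ t * ⟪gradY f x z, b - z⟫ :=
    mul_le_mul_of_nonneg_left (by linarith) ht0
  linarith

/-- The left side is exactly 8er² + 16γζr with r = 2κLγ/α, and the contraction condition says r ≤ 1.
-/
theorem proxAccuracy_sq_le {γ α ζ e : ℝ} (hμ : 0 < μ) (hL : 0 < L) (hγ : 0 < γ)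
    (hα : 0 < α) (hζ : 0 < ζ) (he : 0 < e) (hγα : 2 * (L / μ * L * γ) ≤ α) :
    L / μ * L * proxAccuracy L μ γ α ζ e ^ 2 ≤ 8 * e + 16 * (γ * ζ) := by
  rw [proxAccuracy, mul_pow, Real.sq_sqrt (by positivity)]
  set r := 2 * (L / μ * L * γ) / α with hr
  have hr0 : 0 ≤ r := by positivity
  have hr1 : r ≤ 1 := by rwa [hr, div_le_one hα]
  have e1 : L / μ * L * ((4 * γ) ^ 2 * (2 * (L / μ) * L * e / α ^ 2 + 2 * ζ / α)) =
      8 * e * r ^ 2 + 16 * (γ * ζ) * r := by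
    rw [hr]; field_simp; ring
  rw [e1]
  have h1 : 8 * e * r ^ 2 ≤ 8 * e * 1 :=
    mul_le_mul_of_nonneg_left (pow_le_one₀ hr0 hr1) (by positivity)
  have h2 : 16 * (γ * ζ) * r ≤ 16 * (γ * ζ) * 1 :=
    mul_le_mul_of_nonneg_left hr1 (by positivity)
  linarith

/-- With e = ε_k/(64κ), this makes 8e and 16γζ equal to ε_k/(8κ) each. -/
theorem gammaParam_mul_zetaParam {κ D : ℝ} (hκ : 0 < κ) (k : ℕ) :
    gammaParam (k + 1) * zetaParam L D (k + 1) = epsParam κ L D (k + 1) / (128 * κ) := by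
  simp only [gammaParam, zetaParam, epsParam]
  push_cast
  field_simp
  ring

theorem gammaParam_le_alphaParam {κ : ℝ} (hκ : 0 < κ) (hL : 0 < L) (k : ℕ) :
    2 * (κ * L * gammaParam k) ≤ alphaParam κ L k := by
  simp only [gammaParam, alphaParam]
  rw [mul_div_assoc', mul_div_assoc', div_le_div_iff₀ (by positivity) (by positivity)]
  have : 0 < κ * L := by positivity
  nlinarith

/-- This ratio governs the cost of one CndG call over X, which therefore grows linearly with the
round. -/
theorem alphaParam_div_zetaParam {κ D : ℝ} (hL : 0 < L) (hD : 0 < D) (k : ℕ) :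
    alphaParam κ L (k + 1) * D ^ 2 / zetaParam L D (k + 1) = 2304 * κ * (k + 1 : ℕ) := by
  simp only [zetaParam, alphaParam]
  push_cast
  field_simp
  ring

/-- The accuracy that MPCGS asks from CGS in its `k`-th iteration. -/
noncomputable def cgsAccuracy (κ L D : ℝ) (k : ℕ) : ℝ := epsParam κ L D k / (64 * κ)

/-- The accuracy of Prox-step in the `k`-th iteration of MPCGS. -/
noncomputable def mpAccuracy (L μ D : ℝ) (k : ℕ) : ℝ :=
  proxAccuracy L μ (gammaParam k) (alphaParam (L / μ) L k) (zetaParam L D k)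
    (cgsAccuracy (L / μ) L D k)

theorem mpAccuracy_sq_le {D : ℝ} (hμ : 0 < μ) (hμL : μ ≤ L) (hD : 0 < D) (k : ℕ) :
    L / μ * L * mpAccuracy L μ D (k + 1) ^ 2 ≤ epsParam (L / μ) L D (k + 1) / 4 := by
  have hL : 0 < L := hμ.trans_le hμL
  have hκ : 0 < L / μ := by positivity
  have hκ1 : 1 ≤ L / μ := by rwa [le_div_iff₀ hμ, one_mul]
  have hε : 0 < epsParam (L / μ) L D (k + 1) := by rw [epsParam]; positivity
  have h := proxAccuracy_sq_le hμ hL (γ := gammaParam (k + 1)) (α := alphaParam (L / μ) L (k + 1))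
    (ζ := zetaParam L D (k + 1)) (e := cgsAccuracy (L / μ) L D (k + 1))
    (by rw [gammaParam]; positivity) (by rw [alphaParam]; positivity)
    (by rw [zetaParam]; positivity) (by rw [cgsAccuracy]; positivity)
    (gammaParam_le_alphaParam hκ hL _)
  rw [gammaParam_mul_zetaParam hκ, cgsAccuracy] at h
  refine h.trans ?_
  have e1 : 8 * (epsParam (L / μ) L D (k + 1) / (64 * (L / μ))) +
      16 * (epsParam (L / μ) L D (k + 1) / (128 * (L / μ))) =
      epsParam (L / μ) L D (k + 1) / 4 / (L / μ) := by
    field_simp; norm_num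
  rw [e1]
  exact div_le_self (by positivity) hκ1

theorem mpAccuracy_lt {D : ℝ} (hμ : 0 < μ) (hμL : μ ≤ L) (hD : 0 < D) (k : ℕ) :
    mpAccuracy L μ D (k + 1) < 4 * D := by
  have hL : 0 < L := hμ.trans_le hμL
  have h := mpAccuracy_sq_le hμ hμL hD k
  have hP : 0 < L / μ * L := by positivity
  have h1 : epsParam (L / μ) L D (k + 1) ≤ L / μ * L * D ^ 2 := by
    rw [epsParam]
    apply div_le_self (by positivity)
    push_cast
    have : (0 : ℝ) ≤ k := by positivity
    nlinarith [mul_nonneg this this, mul_nonneg this (mul_nonneg this this)]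
  have h2 : L / μ * L * mpAccuracy L μ D (k + 1) ^ 2 < L / μ * L * (4 * D) ^ 2 := by
    have : 0 < L / μ * L * D ^ 2 := by positivity
    nlinarith
  exact lt_of_pow_lt_pow_left₀ 2 (by positivity) (lt_of_mul_lt_mul_left h2 hP.le)

/-- The invariant of MPCGS. -/
structure MPInvariant (f : E → F → ℝ) (X : Set E) (Y : Set F) (P D : ℝ) (k : ℕ)
    (s : MPState E F) : Prop where
  x_mem : s.x ∈ X
  y_mem : s.y ∈ Y
  v_mem : s.v ∈ X
  gap : ∃ ybar ∈ Y, s.ysum = ((k : ℝ) * (k + 1) * (k + 2) / 3) • ybar ∧ ∀ x ∈ X, ∀ y ∈ Y,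
    (k : ℝ) * (k + 1) * (k + 2) * f s.x y + 9 * P * k * ‖s.v - x‖ ^ 2 ≤
      (k : ℝ) * (k + 1) * (k + 2) * f x ybar + 12 * P * D ^ 2 * k

/-- The requirement on CGS in the `k`-th iteration of MPCGS, with bounds `A` and `B` on the
numbers of oracle calls. -/
def CGSReaches (loY : F → F) (X : Set E) (Y : Set F) (f : E → F → ℝ) (L μ : ℝ)
    (δ₀ : E → F → ℝ) (inner : ℝ → ℝ → ℝ → ℕ) (e A B : ℝ) : Prop :=
  ∀ y₀ ∈ Y, ∀ x ∈ X, ∃ out, cgs loY (fun y => -f x y) L μ (δ₀ x y₀)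
    (inner (L / μ) (δ₀ x y₀) e) y₀ = some out ∧ out.val ∈ Y ∧
    (∀ y' ∈ Y, f x y' - e ≤ f x out.val) ∧ (out.fo : ℝ) ≤ A ∧ (out.lo : ℝ) ≤ B

/-- The coefficient of the squared distance grows by 9P each round, at a price of at most 9PD². The
inexact maximizer costs 50/32 and the prox gap 1/128 of PD², so 12PD² per round suffices. -/
theorem mpcgsStep_spec (hf : IsConvexStronglyConcave f X Y L μ) (hμL : μ ≤ L)
    (hDX : ∀ a ∈ X, ∀ b ∈ X, ‖a - b‖ ≤ Metric.diam X) (hD : 0 < Metric.diam X)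
    {loX : E → E} (hloX : IsLinOracle X loX) (loY : F → F) (δ₀ : E → F → ℝ)
    (inner : ℝ → ℝ → ℝ → ℕ) {A B : ℝ} (k : ℕ)
    (hcgs : CGSReaches loY X Y f L μ δ₀ inner
      (cgsAccuracy (L / μ) L (Metric.diam X) (k + 1)) A B)
    {s : MPState E F} (hs : MPInvariant f X Y (L / μ * L) (Metric.diam X) k s) :
    ∃ out, mpcgsStep loX loY X Y f L μ δ₀ inner gammaParam (alphaParam (L / μ) L)
        (zetaParam L (Metric.diam X)) (epsParam (L / μ) L (Metric.diam X)) (k + 1) s = some out ∧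
      MPInvariant f X Y (L / μ * L) (Metric.diam X) (k + 1) out.val ∧
      (out.fo : ℝ) ≤
        ⌈Real.logb 2 (4 * Metric.diam X / mpAccuracy L μ (Metric.diam X) (k + 1))⌉₊ * (A + 1) ∧
      (out.lo : ℝ) ≤
        ⌈Real.logb 2 (4 * Metric.diam X / mpAccuracy L μ (Metric.diam X) (k + 1))⌉₊ *
          (B + (18432 * (L / μ) * (k + 1 : ℕ) + 10)) := by
  have hμ := hf.mu_pos
  have hL := hf.L_pos
  have hκ : 0 < L / μ := by positivity
  have hκ1 : 1 ≤ L / μ := by rwa [le_div_iff₀ hμ, one_mul]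
  set D := Metric.diam X with hDdef
  set κ := L / μ with hκdef
  obtain ⟨ybar, hybar, hysum, hgap⟩ := hs.gap
  set γ := gammaParam (k + 1) with hγ
  set α := alphaParam κ L (k + 1) with hα
  set ζ := zetaParam L D (k + 1) with hζ
  set ε := epsParam κ L D (k + 1) with hε
  set e := cgsAccuracy κ L D (k + 1) with he
  have hγ0 : 0 < γ := by rw [hγ, gammaParam]; positivity
  have hγ1 : γ ≤ 1 := by
    rw [hγ, gammaParam, div_le_one (by positivity)]; push_cast
    linarith [(Nat.cast_nonneg k : (0 : ℝ) ≤ k)]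
  have hα0 : 0 < α := by rw [hα, alphaParam]; positivity
  have hζ0 : 0 < ζ := by rw [hζ, zetaParam]; positivity
  have hε0 : 0 < ε := by rw [hε, epsParam]; positivity
  have he0 : 0 < e := by rw [he, cgsAccuracy]; positivity
  have hγα : 2 * (κ * L * γ) ≤ α := gammaParam_le_alphaParam hκ hL _
  set z := (1 - γ) • s.x + γ • s.v with hz
  have hzX : z ∈ X := hf.convex_X hs.x_mem hs.v_mem (by linarith) hγ0.le (by ring)
  obtain ⟨o, ho, hox, hoy, hov, hoeq, hogap, hoem, hofo, holo⟩ :=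
    proxStep_spec hf hDX hloX loY δ₀ inner (ε := ε) (e := e) hs.x_mem hs.v_mem hzX hγ0 hγ1 hα0
      hζ0 he0 rfl hγα (mpAccuracy_lt hμ hμL hD k) (hcgs s.y hs.y_mem)
  have hW : (0 : ℝ) < ((k : ℝ) + 1) * (k + 2) * (k + 3) := by positivity
  refine ⟨_, by rw [mpcgsStep, ho, Option.map_some], ⟨hox, hoy, hov,
    (1 - γ) • ybar + γ • o.val.2.1, hf.convex_Y hybar hoy (by linarith) hγ0.le (by ring), ?_,
    ?_⟩, hofo, ?_⟩
  · simp only [hysum]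
    rw [smul_add, smul_smul, smul_smul, hγ, gammaParam]
    push_cast
    congr 2 <;> field_simp <;> ring
  · intro x hx y hy
    dsimp only
    have h1 := accelerated_step (fun x => f x o.val.2.1) (gradX f z o.val.2.1) s.x s.v o.val.2.2 x
      z o.val.1 L γ α ζ hγ0.le hγ1
      (by
        have : 1 * (L * γ) ≤ κ * (L * γ) := mul_le_mul_of_nonneg_right hκ1 (by positivity)
        have : 0 < L * γ := by positivity
        linarith)
      hz hoeq (hf.descent_X hoy hzX hox)
      (by linarith [hf.convex _ hoy _ hs.x_mem _ hzX]) (by linarith [hf.convex _ hoy _ hx _ hzX])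
      (hogap x hx)
    -- The invariant holds for every y in Y, so it may be tested at the new y_k, unknown when it was
    -- established.
    have h2 := hgap x hx _ hoy
    have h3 := hf.concave_Y hx hybar hoy hγ0.le hγ1
    have h4 := hoem y hy
    have h5 : κ * L * proxAccuracy L μ γ α ζ e ^ 2 ≤ ε / 4 := mpAccuracy_sq_le hμ hμL hD k
    have h6 : γ * ζ ≤ ε / 128 := by
      rw [gammaParam_mul_zetaParam hκ]
      apply div_le_div_of_nonneg_left hε0.le (by norm_num)
      linarith
    have h7 : 2 * e ≤ ε / 32 := by
      have : e ≤ ε / 64 := by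
        apply div_le_div_of_nonneg_left hε0.le (by norm_num)
        linarith
      linarith
    have hDv := hDX _ hs.v_mem _ hx
    have h8 : ‖s.v - x‖ ^ 2 ≤ D ^ 2 := pow_le_pow_left₀ (norm_nonneg _) hDv 2
    set W := ((k : ℝ) + 1) * (k + 2) * (k + 3) with hWdef
    have eγ : W * (1 - γ) = k * (k + 1) * (k + 2) := by
      rw [hWdef, hγ, gammaParam]; push_cast; field_simp; ring
    have eα : W * (γ * α / 2) = 9 * (κ * L) * (k + 1) := by
      rw [hWdef, hγ, gammaParam, hα, alphaParam]; push_cast; field_simp; ring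
    have eε : W * ε = κ * L * D ^ 2 := by
      rw [hWdef, hε, epsParam]; push_cast; field_simp; ring
    have hWk : ((k + 1 : ℕ) : ℝ) * ((k + 1 : ℕ) + 1) * ((k + 1 : ℕ) + 2) = W := by
      rw [hWdef]; push_cast; ring
    rw [hWk]
    have hP : 0 < κ * L := by positivity
    set φ := f o.val.1 o.val.2.1 with hφ
    -- Here 50/32 = 1/32 + 6 · 1/4, from 2e and from 6κLρ².
    have i1 : W * f o.val.1 y ≤ W * φ + 50 / 32 * (κ * L * D ^ 2) := by
      have : W * f o.val.1 y ≤ W * (φ + 50 / 32 * ε) :=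
        mul_le_mul_of_nonneg_left (by linarith) hW.le
      rw [← eε]; linarith
    have i2 := mul_le_mul_of_nonneg_left h1 hW.le
    have i3 : W * (γ * ζ) ≤ κ * L * D ^ 2 / 128 := by
      have := mul_le_mul_of_nonneg_left h6 hW.le
      rw [← eε]; linarith
    have i4 := mul_le_mul_of_nonneg_left h3 hW.le
    have i5 : W * ((1 - γ) * f s.x o.val.2.1 + γ * f x o.val.2.1 + γ * ζ +
        γ * α / 2 * (‖s.v - x‖ ^ 2 - ‖o.val.2.2 - x‖ ^ 2)) =
        k * (k + 1) * (k + 2) * f s.x o.val.2.1 + W * γ * f x o.val.2.1 + W * (γ * ζ) +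
        9 * (κ * L) * (k + 1) * (‖s.v - x‖ ^ 2 - ‖o.val.2.2 - x‖ ^ 2) := by
      rw [← eγ, ← eα]; ring
    have i6 : W * ((1 - γ) * f x ybar + γ * f x o.val.2.1) =
        k * (k + 1) * (k + 2) * f x ybar + W * γ * f x o.val.2.1 := by
      rw [← eγ]; ring
    rw [i5] at i2
    rw [i6] at i4
    have i7 : κ * L * ‖s.v - x‖ ^ 2 ≤ κ * L * D ^ 2 := mul_le_mul_of_nonneg_left h8 hP.le
    push_cast
    have i8 : 0 < κ * L * D ^ 2 := by positivity
    linarith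
  · refine holo.trans (le_of_eq ?_)
    have e1 : 8 * (α * D ^ 2) / ζ = 18432 * κ * (k + 1 : ℕ) := by
      rw [mul_div_assoc, hα, hζ, alphaParam_div_zetaParam hL hD]; ring
    rw [← hDdef, e1]
    rfl

/-- Convergence of MPCGS, with bounds on the numbers of oracle calls. -/
theorem mpcgs_spec (hf : IsConvexStronglyConcave f X Y L μ) (hμL : μ ≤ L)
    (hDX : ∀ a ∈ X, ∀ b ∈ X, ‖a - b‖ ≤ Metric.diam X) (hD : 0 < Metric.diam X)
    {loX : E → E} (hloX : IsLinOracle X loX) (loY : F → F) (δ₀ : E → F → ℝ)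
    (inner : ℝ → ℝ → ℝ → ℕ) {A B R : ℝ} (hA : 0 ≤ A) (hB : 0 ≤ B) {N : ℕ} (hN : 0 < N)
    (hcgs : ∀ k < N, CGSReaches loY X Y f L μ δ₀ inner
      (cgsAccuracy (L / μ) L (Metric.diam X) (k + 1)) A B)
    (hR : ∀ k < N,
      (⌈Real.logb 2 (4 * Metric.diam X / mpAccuracy L μ (Metric.diam X) (k + 1))⌉₊ : ℝ) ≤ R)
    {x₀ : E} {y₀ : F} (hx₀ : x₀ ∈ X) (hy₀ : y₀ ∈ Y) :
    ∃ out, mpcgs loX loY X Y f L μ δ₀ inner gammaParam (alphaParam (L / μ) L)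
        (zetaParam L (Metric.diam X)) (epsParam (L / μ) L (Metric.diam X)) N x₀ y₀ = some out ∧
      out.val.1 ∈ X ∧ out.val.2 ∈ Y ∧
      (∀ x ∈ X, ∀ y ∈ Y, f out.val.1 y - f x out.val.2 ≤
        12 * (L / μ * L) * Metric.diam X ^ 2 / (N : ℝ) ^ 2) ∧
      (out.fo : ℝ) ≤ N * (R * (A + 1)) ∧
      (out.lo : ℝ) ≤ N * (R * (B + (18432 * (L / μ) * N + 10))) := by
  have hμ := hf.mu_pos
  have hL := hf.L_pos
  have hP : 0 < L / μ * L := by positivity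
  obtain ⟨o, ho, hinv, hfo, hlo⟩ := forLoop_invariant
    (mpcgsStep loX loY X Y f L μ δ₀ inner gammaParam (alphaParam (L / μ) L)
        (zetaParam L (Metric.diam X)) (epsParam (L / μ) L (Metric.diam X)))
    (MPInvariant f X Y (L / μ * L) (Metric.diam X)) (R * (A + 1))
    (R * (B + (18432 * (L / μ) * N + 10))) ⟨x₀, y₀, x₀, 0⟩ N
    -- At k = 0 all weights vanish, so any point of Y can serve as the average.
    ⟨hx₀, hy₀, hx₀, y₀, hy₀, by simp, by simp⟩
    (fun k hk s hs => by
      obtain ⟨o, ho, hinv, hfo, hlo⟩ :=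
        mpcgsStep_spec hf hμL hDX hD hloX loY δ₀ inner k (hcgs k hk) hs
      refine ⟨o, ho, hinv, hfo.trans ?_, hlo.trans ?_⟩
      · exact mul_le_mul_of_nonneg_right (hR k hk) (by linarith)
      · have : ((k + 1 : ℕ) : ℝ) ≤ N := by exact_mod_cast hk
        have h0 : (0 : ℝ) ≤ R := le_trans (Nat.cast_nonneg _) (hR k hk)
        have := hR k hk
        gcongr)
  obtain ⟨ybar, hybar, hysum, hgap⟩ := hinv.gap
  have hN' : (0 : ℝ) < N := by exact_mod_cast hN
  have hout : (3 / ((N : ℝ) * (N + 1) * (N + 2))) • o.val.ysum = ybar := by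
    rw [hysum, smul_smul]
    have : 3 / ((N : ℝ) * (N + 1) * (N + 2)) * ((N : ℝ) * (N + 1) * (N + 2) / 3) = 1 := by
      field_simp
    rw [this, one_smul]
  refine ⟨⟨(o.val.x, ybar), o.fo, o.lo⟩, ?_, hinv.x_mem, hybar, ?_, hfo, hlo⟩
  · rw [mpcgs, ho, Option.map_some, hout]
  · intro x hx y hy
    have h1 := hgap x hx y hy
    rw [le_div_iff₀ (by positivity)]
    dsimp only
    set d := f o.val.x y - f x ybar with hd
    have h0 : 0 ≤ 9 * (L / μ * L) * N * ‖o.val.v - x‖ ^ 2 := by positivity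
    have h2 : N * (d * ((N + 1) * (N + 2))) ≤ N * (12 * (L / μ * L) * Metric.diam X ^ 2) := by
      rw [hd]; linarith
    have h3 := le_of_mul_le_mul_left h2 hN'
    rcases le_total d 0 with h | h
    · have : d * (N : ℝ) ^ 2 ≤ 0 := mul_nonpos_of_nonpos_of_nonneg h (by positivity)
      have : 0 ≤ 12 * (L / μ * L) * Metric.diam X ^ 2 := by positivity
      linarith
    · have : d * (N : ℝ) ^ 2 ≤ d * ((N + 1) * (N + 2)) :=
        mul_le_mul_of_nonneg_left (by nlinarith) h
      linarith

end MirrorProx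

/-! ### Bounds uniform in the round, and counting of oracle calls -/

section Complexity

variable {E : Type*} [NormedAddCommGroup E] [InnerProductSpace ℝ E] [CompleteSpace E]
variable {F : Type*} [NormedAddCommGroup F] [InnerProductSpace ℝ F] [CompleteSpace F]
variable {f : E → F → ℝ} {X : Set E} {Y : Set F} {L μ : ℝ}

theorem cgsAccuracy_ge {κ D : ℝ} (hκ : 0 < κ) (hL : 0 < L) {k N : ℕ} (hk : k < N) :
    L * D ^ 2 / (384 * (N : ℝ) ^ 3) ≤ cgsAccuracy κ L D (k + 1) := by
  have hkN : (k : ℝ) + 1 ≤ N := by exact_mod_cast hk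
  have hk0 : (0 : ℝ) ≤ k := Nat.cast_nonneg k
  have e1 : cgsAccuracy κ L D (k + 1) = L * D ^ 2 / (64 * ((k + 1) * (k + 2) * (k + 3))) := by
    rw [cgsAccuracy, epsParam]; push_cast; field_simp; ring
  rw [e1]
  apply div_le_div_of_nonneg_left (by positivity) (by positivity)
  calc 64 * (((k : ℝ) + 1) * (k + 2) * (k + 3)) ≤ 64 * (N * (2 * N) * (3 * N)) := by
        gcongr <;> linarith
    _ = _ := by ring

/-- A bound on the number of iterations of Prox-step. -/
theorem rounds_le {D : ℝ} (hμ : 0 < μ) (hμL : μ ≤ L) (hD : 0 < D) {k N : ℕ} (hk : k < N) :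
    ⌈Real.logb 2 (4 * D / mpAccuracy L μ D (k + 1))⌉₊ ≤
      ⌈Real.logb 2 (1152 * (L / μ) * (N : ℝ) ^ 3)⌉₊ := by
  have hL : 0 < L := hμ.trans_le hμL
  have hkN : (k : ℝ) + 1 ≤ N := by exact_mod_cast hk
  have hk0 : (0 : ℝ) ≤ k := Nat.cast_nonneg k
  have hρ : 0 < mpAccuracy L μ D (k + 1) := by
    rw [mpAccuracy, proxAccuracy, gammaParam, alphaParam, zetaParam, cgsAccuracy, epsParam]
    positivity
  -- Only the ζ term of the accuracy is kept; it alone gives a polynomial lower bound.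
  have h1 : D ^ 2 / (72 * (L / μ) * (N : ℝ) ^ 3) ≤ mpAccuracy L μ D (k + 1) ^ 2 := by
    rw [mpAccuracy, proxAccuracy, mul_pow, Real.sq_sqrt (by
      rw [alphaParam, zetaParam, cgsAccuracy, epsParam]; positivity)]
    have h2 : (0 : ℝ) ≤ 2 * (L / μ) * L * cgsAccuracy (L / μ) L D (k + 1) /
        alphaParam (L / μ) L (k + 1) ^ 2 := by
      rw [alphaParam, cgsAccuracy, epsParam]; positivity
    have h3 : (4 * gammaParam (k + 1)) ^ 2 *
        (2 * zetaParam L D (k + 1) / alphaParam (L / μ) L (k + 1)) =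
        D ^ 2 / (8 * (L / μ) * ((k + 1) * (k + 3) ^ 2)) := by
      rw [gammaParam, alphaParam, zetaParam]; push_cast; field_simp; ring
    have h4 : D ^ 2 / (72 * (L / μ) * (N : ℝ) ^ 3) ≤
        D ^ 2 / (8 * (L / μ) * ((k + 1) * (k + 3) ^ 2)) := by
      apply div_le_div_of_nonneg_left (by positivity) (by positivity)
      calc 8 * (L / μ) * (((k : ℝ) + 1) * (k + 3) ^ 2) ≤ 8 * (L / μ) * (N * (3 * N) ^ 2) := by
            gcongr; linarith
        _ = _ := by ring
    refine h4.trans (h3.symm.le.trans ?_)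
    exact mul_le_mul_of_nonneg_left (by linarith) (by positivity)
  have h5 : 1 < 4 * D / mpAccuracy L μ D (k + 1) := by
    rw [one_lt_div hρ]; exact mpAccuracy_lt hμ hμL hD k
  apply Nat.ceil_mono
  apply Real.logb_le_logb_of_le (by norm_num) (by linarith)
  have hN : (0 : ℝ) < N := by linarith
  have h6 : (4 * D / mpAccuracy L μ D (k + 1)) ^ 2 ≤ 1152 * (L / μ) * (N : ℝ) ^ 3 := by
    rw [div_pow, div_le_iff₀ (by positivity)]
    rw [div_le_iff₀ (by positivity)] at h1
    linarith
  -- A number above 1 is at most its square, which `h6` bounds.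
  nlinarith

/-- The cost bounds increase as the accuracy shrinks, so a common lower bound e for all rounds gives
one bound for all. -/
theorem cgsReaches_outerIterations (hf : IsConvexStronglyConcave f X Y L μ) (hμL : μ ≤ L)
    {DX DY : ℝ} (hDX : 0 < DX) (hDY : ∀ a ∈ Y, ∀ b ∈ Y, ‖a - b‖ ≤ DY)
    {loY : F → F} (hloY : IsLinOracle Y loY) {δ₀ : E → F → ℝ} {Δ : ℝ} (hΔ : 0 < Δ)
    (hδ₀ : ∀ x ∈ X, ∀ y ∈ Y, 0 < δ₀ x y ∧ δ₀ x y ≤ Δ ∧ ∀ y' ∈ Y, f x y' - f x y ≤ δ₀ x y)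
    {k N : ℕ} (hk : k < N) {e : ℝ} (he : e = L * DX ^ 2 / (384 * (N : ℝ) ^ 3)) :
    CGSReaches loY X Y f L μ δ₀ outerIterations (cgsAccuracy (L / μ) L DX (k + 1))
      (outerIterations (L / μ) Δ e * ⌈√(24 * L / μ)⌉₊)
      (outerIterations (L / μ) Δ e * (⌈√(24 * L / μ)⌉₊ *
        (28 * μ * outerIterations (L / μ) Δ e * √(L / μ) * DY ^ 2 / e + 10))) := by
  have hμ := hf.mu_pos
  have hL := hf.L_pos
  have hN : (0 : ℝ) < N := by exact_mod_cast (Nat.zero_le k).trans_lt hk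
  have hee : e ≤ cgsAccuracy (L / μ) L DX (k + 1) := he ▸ cgsAccuracy_ge (by positivity) hL hk
  have he0 : 0 < e := by rw [he]; positivity
  have hacc : 0 < cgsAccuracy (L / μ) L DX (k + 1) := he0.trans_le hee
  intro y₀ hy₀ x hx
  obtain ⟨h1, h2, h3⟩ := hδ₀ x hx y₀ hy₀
  obtain ⟨o, ho, hoY, hoem, hofo, holo⟩ := cgs_outerIterations_spec hf hμL hDY hloY hx hy₀ h1 h2
    (he0.trans_le hee) h3
  have hT : outerIterations (L / μ) Δ (cgsAccuracy (L / μ) L DX (k + 1)) ≤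
      outerIterations (L / μ) Δ e := by
    apply Nat.ceil_mono
    apply Real.logb_le_logb_of_le (by norm_num) (by positivity)
    gcongr
  have hT' : (outerIterations (L / μ) Δ (cgsAccuracy (L / μ) L DX (k + 1)) : ℝ) ≤
      outerIterations (L / μ) Δ e := by exact_mod_cast hT
  exact ⟨o, ho, hoY, hoem, hofo.trans (by gcongr), holo.trans (by gcongr)⟩

/-- Since log 2 ≥ 2/3, the factor 3/2 covers the change of base, and 3/2 · log G ≥ 1 absorbs the
rounding. -/
theorem ceil_logb_le {G x : ℝ} (hG : 2 ≤ G) (hx : 0 < x) (n : ℕ) (hxG : x ≤ G ^ n) :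
    (⌈Real.logb 2 x⌉₊ : ℝ) ≤ 3 / 2 * (n + 1) * Real.log G := by
  have hlog2 := Real.log_two_gt_d9
  have hΛ : Real.log 2 ≤ Real.log G := Real.log_le_log (by norm_num) hG
  have h1 : Real.logb 2 x ≤ 3 / 2 * n * Real.log G := by
    rw [Real.logb, div_le_iff₀ (by linarith)]
    have h2 := Real.log_le_log hx hxG
    rw [Real.log_pow] at h2
    have h3 : 0 ≤ n * Real.log G := mul_nonneg (by positivity) (by linarith)
    nlinarith
  have h2 : (⌈Real.logb 2 x⌉₊ : ℝ) ≤ ⌈3 / 2 * n * Real.log G⌉₊ := by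
    exact_mod_cast Nat.ceil_mono h1
  have h3 := Nat.ceil_lt_add_one (a := 3 / 2 * n * Real.log G)
    (mul_nonneg (by positivity) (by linarith))
  linarith

/-- The two numbers of oracle calls, in terms of `q = √(κ L D² / ε)`. -/
theorem oracle_calls_le {κ q T M R N Λ v w : ℝ} (hκ : 1 ≤ κ) (hq : 1 ≤ q)
    (hT0 : 0 ≤ T) (hR0 : 0 ≤ R) (hM0 : 0 ≤ M) (hN0 : 0 ≤ N) (hN : N ≤ 5 * q) (hT : T ≤ 39 * Λ)
    (hR : R ≤ 69 / 2 * Λ) (hM : M ≤ 6 * √κ) (hΛ : 2 / 3 ≤ Λ) (hv : 0 ≤ v)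
    (hw : √κ * v * q ^ 2 ≤ 28 * 48000 * w) :
    N * (R * (T * M + 1)) ≤ 3 * 10 ^ 12 * (√κ * q) * Λ ^ 3 ∧
    (κ ≤ w → N * (R * (T * (M * (T * v * q ^ 3 + 10)) + (18432 * κ * N + 10))) ≤
      3 * 10 ^ 12 * (q ^ 2 * w) * Λ ^ 3) := by
  have hρ : 1 ≤ √κ := Real.one_le_sqrt.2 hκ
  have hρκ : √κ * √κ = κ := Real.mul_self_sqrt (by linarith)
  set ρ := √κ with hρdef
  have hΛ0 : 0 ≤ Λ := by linarith
  have hΛ1 : 1 ≤ 3 / 2 * Λ := by linarith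
  have hΛ2 : Λ ≤ 3 / 2 * Λ ^ 2 := by nlinarith
  have hΛ3 : Λ ^ 2 ≤ 3 / 2 * Λ ^ 3 := by nlinarith [mul_nonneg hΛ0 hΛ0]
  have hN' : N * R ≤ 5 * q * (69 / 2 * Λ) := mul_le_mul hN hR hR0 (by positivity)
  constructor
  · have h1 : T * M + 1 ≤ 236 * ρ * Λ := by
      have : T * M ≤ 39 * Λ * (6 * ρ) := mul_le_mul hT hM hM0 (by positivity)
      nlinarith
    calc N * (R * (T * M + 1)) = N * R * (T * M + 1) := by ring
      _ ≤ 5 * q * (69 / 2 * Λ) * (236 * ρ * Λ) := by gcongr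
      _ = 40710 * (ρ * q) * Λ ^ 2 := by ring
      _ ≤ 40710 * (ρ * q) * (3 / 2 * Λ ^ 3) := by gcongr
      _ = 61065 * (ρ * q) * Λ ^ 3 := by ring
      _ ≤ _ := by gcongr; norm_num
  · intro hκw
    have hw0 : 0 ≤ w := by linarith
    have hρκ' : ρ ≤ κ := by nlinarith
    have h1 : q * (T * (M * (T * v * q ^ 3 + 10))) ≤
        (39 ^ 2 * 6 * 28 * 48000 * Λ ^ 2 + 2340 * Λ) * (q ^ 2 * w) := by
      have i1 : T * (M * (T * v * q ^ 3 + 10)) ≤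
          39 * Λ * (6 * ρ * (39 * Λ * v * q ^ 3 + 10)) := by gcongr
      have i2 : q * (39 * Λ * (6 * ρ * (39 * Λ * v * q ^ 3 + 10))) =
          39 ^ 2 * 6 * Λ ^ 2 * q ^ 2 * (ρ * v * q ^ 2) + 2340 * Λ * (q * ρ) := by ring
      have i3 : 39 ^ 2 * 6 * Λ ^ 2 * q ^ 2 * (ρ * v * q ^ 2) ≤
          39 ^ 2 * 6 * Λ ^ 2 * q ^ 2 * (28 * 48000 * w) := by gcongr
      have i4 : q * ρ ≤ q ^ 2 * w := mul_le_mul (by nlinarith) (by linarith) (by linarith)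
        (by positivity)
      have i5 : 2340 * Λ * (q * ρ) ≤ 2340 * Λ * (q ^ 2 * w) := by gcongr
      have i6 := mul_le_mul_of_nonneg_left i1 (by linarith : 0 ≤ q)
      linarith
    -- The calls over X enter here; κ ≤ w is what ε ≤ LD_Y² provides.
    have h2 : q * (18432 * κ * N + 10) ≤ 92170 * (q ^ 2 * w) := by
      have i1 : q * (18432 * κ * N + 10) ≤ q * (18432 * κ * (5 * q) + 10) := by gcongr
      have i2 : q ^ 2 * κ ≤ q ^ 2 * w := by gcongr
      have i3 : q ≤ q ^ 2 * w := by nlinarith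
      linarith
    have h3 : (1 : ℝ) ≤ 9 / 4 * Λ ^ 2 := by linarith
    have hQ : 0 ≤ q ^ 2 * w := by positivity
    have h4 : q * (T * (M * (T * v * q ^ 3 + 10)) + (18432 * κ * N + 10)) ≤
        13 * 10 ^ 9 * Λ ^ 2 * (q ^ 2 * w) := by
      have i1 : 39 ^ 2 * 6 * 28 * 48000 * Λ ^ 2 + 2340 * Λ + 92170 ≤ 13 * 10 ^ 9 * Λ ^ 2 := by
        linarith
      have := mul_le_mul_of_nonneg_right i1 hQ
      linarith
    calc N * (R * (T * (M * (T * v * q ^ 3 + 10)) + (18432 * κ * N + 10)))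
        = N * R * (T * (M * (T * v * q ^ 3 + 10)) + (18432 * κ * N + 10)) := by ring
      _ ≤ 5 * q * (69 / 2 * Λ) * (T * (M * (T * v * q ^ 3 + 10)) + (18432 * κ * N + 10)) := by
          gcongr
      _ = 345 / 2 * Λ * (q * (T * (M * (T * v * q ^ 3 + 10)) + (18432 * κ * N + 10))) := by ring
      _ ≤ 345 / 2 * Λ * (13 * 10 ^ 9 * Λ ^ 2 * (q ^ 2 * w)) := by gcongr
      _ = 345 / 2 * 13 * 10 ^ 9 * (q ^ 2 * w * Λ ^ 3) := by ring
      _ ≤ 3 * 10 ^ 12 * (q ^ 2 * w * Λ ^ 3) :=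
          mul_le_mul_of_nonneg_right (by norm_num) (by positivity)
      _ = _ := by ring

end Complexity

/-! ### Logarithmic factors and the final assembly -/

section Complexity

theorem pow_factor_le {G : ℝ} (hG : 2 ≤ G) {a b : ℕ} {c : ℝ} (hc : c ≤ 2 ^ a) :
    c * G ^ b ≤ G ^ (a + b) := by
  rw [pow_add]
  have : (2 : ℝ) ^ a ≤ G ^ a := pow_le_pow_left₀ (by norm_num) hG a
  exact mul_le_mul_of_nonneg_right (hc.trans this) (by positivity)

/-- Logarithmic bounds on the number of outer iterations of CGS and on the number of iterations of
Prox-step, where `u = L D² / ε`, `d = Δ / ε` and `q = √(κ u)`. -/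
theorem log_iterations_le {κ u d q N G x y : ℝ} (hκ : 1 ≤ κ) (hu : 0 < u) (hd : 0 < d)
    (hq : 1 ≤ q) (hqu : q ^ 2 = κ * u) (hN0 : 0 < N) (hN : N ≤ 5 * q) (hG : G = 2 + κ + u + d)
    (hx : x = 7 * √κ * (384 * N ^ 3 * (d / u))) (hy : y = 1152 * κ * N ^ 3) :
    (⌈Real.logb 2 x⌉₊ : ℝ) ≤ 39 * Real.log G ∧ (⌈Real.logb 2 y⌉₊ : ℝ) ≤ 69 / 2 * Real.log G := by
  have hG2 : 2 ≤ G := by linarith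
  have hκG : κ ≤ G := by linarith
  have hqG : q ≤ G := by
    have : q ^ 2 ≤ G ^ 2 := by
      rw [hqu, sq]; exact mul_le_mul hκG (by linarith) hu.le (by linarith)
    exact (pow_le_pow_iff_left₀ (by linarith) (by linarith) (by norm_num)).1 this
  have hN3 : N ^ 3 ≤ 125 * G ^ 3 := by
    calc N ^ 3 ≤ (5 * G) ^ 3 := pow_le_pow_left₀ hN0.le (by linarith) 3
      _ = _ := by ring
  have hρ : √κ ≤ G := (Real.sqrt_le_iff.2 ⟨by linarith, by nlinarith⟩ : √κ ≤ κ).trans hκG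
  have hρ0 : 0 < √κ := Real.sqrt_pos.2 (by linarith)
  have hdu : d / u ≤ G ^ 2 := by
    -- The ratio Δ/(LD²) is not directly one of the terms of G, but κu = q² ≥ 1 bounds 1/u by κ.
    have h1 : d / u ≤ d * κ := by
      rw [div_le_iff₀ hu, mul_assoc, ← hqu]
      exact le_mul_of_one_le_right hd.le (one_le_pow₀ hq)
    have h2 : d * κ ≤ G * G := mul_le_mul (by linarith) hκG (by linarith) (by linarith)
    linarith [sq G]
  constructor
  · have h1 : x ≤ G ^ 25 := by
      calc x ≤ 7 * G * (384 * (125 * G ^ 3) * G ^ 2) := by rw [hx]; gcongr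
        _ = 336000 * G ^ 6 := by ring
        _ ≤ G ^ (19 + 6) := pow_factor_le hG2 (by norm_num)
    have := ceil_logb_le hG2 (by rw [hx]; positivity) 25 h1
    norm_num at this ⊢
    linarith
  · have h1 : y ≤ G ^ 22 := by
      calc y ≤ 1152 * G * (125 * G ^ 3) := by rw [hy]; gcongr
        _ = 144000 * G ^ 4 := by ring
        _ ≤ G ^ (18 + 4) := pow_factor_le hG2 (by norm_num)
    have := ceil_logb_le hG2 (by rw [hy]; positivity) 22 h1
    norm_num at this ⊢
    linarith

variable {E : Type*} [NormedAddCommGroup E] [InnerProductSpace ℝ E] [CompleteSpace E]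
variable {F : Type*} [NormedAddCommGroup F] [InnerProductSpace ℝ F] [CompleteSpace F]
variable {f : E → F → ℝ} {X : Set E} {Y : Set F} {L μ : ℝ}

theorem IsConvexStronglyConcave.isSaddlePoint (hf : IsConvexStronglyConcave f X Y L μ) {ε : ℝ}
    {x : E} {y : F} (hx : x ∈ X) (hy : y ∈ Y)
    (h : ∀ x' ∈ X, ∀ y' ∈ Y, f x y' - f x' y ≤ ε) : IsSaddlePoint f X Y ε x y := by
  obtain ⟨b, hb, hbm⟩ := hf.exists_argmax ⟨y, hy⟩ hx
  obtain ⟨a, ha, ham⟩ := hf.compact_X.exists_isMinOn ⟨x, hx⟩ (hf.continuousOn_X hy)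
  refine ⟨hx, hy, f x b, f a y, ⟨⟨b, hb, rfl⟩, ?_⟩, ⟨⟨a, ha, rfl⟩, ?_⟩, h a ha b hb⟩
  · rintro _ ⟨y', hy', rfl⟩; exact hbm y' hy'
  · rintro _ ⟨x', hx', rfl⟩; exact ham hx'

/-- The number of iterations of MPCGS. -/
noncomputable def mpIterations (κ L D ε : ℝ) : ℕ := ⌈√(12 * (κ * (L * D ^ 2 / ε)))⌉₊

theorem mpcgs_complexity (hf : IsConvexStronglyConcave f X Y L μ) (hX : X.Nontrivial)
    (hY : Y.Nontrivial) {loX : E → E} {loY : F → F} (hloX : IsLinOracle X loX)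
    (hloY : IsLinOracle Y loY) {x₀ : E} {y₀ : F} (hx₀ : x₀ ∈ X) (hy₀ : y₀ ∈ Y)
    {δ₀ : E → F → ℝ} {Δ : ℝ}
    (hδ₀ : ∀ x ∈ X, ∀ y ∈ Y, 0 < δ₀ x y ∧ δ₀ x y ≤ Δ ∧ ∀ y' ∈ Y, f x y' - f x y ≤ δ₀ x y)
    {ε : ℝ} (hε : 0 < ε) :
    ∃ out, mpcgs loX loY X Y f L μ δ₀ outerIterations gammaParam (alphaParam (L / μ) L)
        (zetaParam L (Metric.diam X)) (epsParam (L / μ) L (Metric.diam X))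
        (mpIterations (L / μ) L (Metric.diam X) ε) x₀ y₀ = some out ∧
      IsSaddlePoint f X Y ε out.val.1 out.val.2 ∧
      (ε ≤ L / μ * L * Metric.diam X ^ 2 →
        (out.fo : ℝ) ≤ 3 * 10 ^ 12 * (L / μ * √(L * Metric.diam X ^ 2 / ε)) *
          logFactor (L / μ) L (Metric.diam X) Δ ε ^ 3) ∧
      (ε ≤ L / μ * L * Metric.diam X ^ 2 → ε ≤ L * Metric.diam Y ^ 2 →
        (out.lo : ℝ) ≤
          3 * 10 ^ 12 * ((L / μ) ^ 2 * L ^ 2 * Metric.diam X ^ 2 * Metric.diam Y ^ 2 / ε ^ 2) *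
          logFactor (L / μ) L (Metric.diam X) Δ ε ^ 3) := by
  have hμ := hf.mu_pos
  have hL := hf.L_pos
  have hμL := hf.mu_le_L hX.nonempty hY
  have hDX : ∀ a ∈ X, ∀ b ∈ X, ‖a - b‖ ≤ Metric.diam X := fun a ha b hb =>
    dist_eq_norm a b ▸ Metric.dist_le_diam_of_mem hf.compact_X.isBounded ha hb
  have hDY : ∀ a ∈ Y, ∀ b ∈ Y, ‖a - b‖ ≤ Metric.diam Y := fun a ha b hb =>
    dist_eq_norm a b ▸ Metric.dist_le_diam_of_mem hf.compact_Y.isBounded ha hb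
  have hD : 0 < Metric.diam X := by
    obtain ⟨a, ha, b, hb, hab⟩ := hX
    exact (norm_pos_iff.2 (sub_ne_zero.2 hab)).trans_le (hDX a ha b hb)
  set D := Metric.diam X with hDdef
  set D' := Metric.diam Y with hD'def
  have hκ : 1 ≤ L / μ := by rwa [le_div_iff₀ hμ, one_mul]
  have hκ0 : 0 < L / μ := by positivity
  set κ := L / μ with hκdef
  have hΔ : 0 < Δ := (hδ₀ x₀ hx₀ y₀ hy₀).1.trans_le (hδ₀ x₀ hx₀ y₀ hy₀).2.1
  set u := L * D ^ 2 / ε with hu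
  have hu0 : 0 < u := by positivity
  set N := mpIterations κ L D ε with hNdef
  have hNpos : 0 < N := Nat.ceil_pos.2 (Real.sqrt_pos.2 (by positivity))
  have hN' : (0 : ℝ) < N := by exact_mod_cast hNpos
  have hNsq : 12 * (κ * u) ≤ (N : ℝ) ^ 2 :=
    (Real.sqrt_le_left hN'.le).1 (Nat.le_ceil _)
  set e := L * D ^ 2 / (384 * (N : ℝ) ^ 3) with he
  have he0 : 0 < e := by positivity
  set T := outerIterations κ Δ e with hT
  set M := ⌈√(24 * L / μ)⌉₊ with hM
  set R := ⌈Real.logb 2 (1152 * κ * (N : ℝ) ^ 3)⌉₊ with hR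
  obtain ⟨o, ho, hox, hoy, hgap, hfo, hlo⟩ := mpcgs_spec hf hμL hDX hD hloX loY δ₀ outerIterations
    (A := T * M) (B := T * (M * (28 * μ * T * √κ * D' ^ 2 / e + 10))) (R := R)
    (by positivity) (by positivity) hNpos
    (fun k hk => cgsReaches_outerIterations hf hμL hD hDY hloY hΔ hδ₀ hk he)
    (fun k hk => Nat.cast_le.2 (rounds_le hμ hμL hD hk)) hx₀ hy₀
  have hcalls : ε ≤ κ * L * D ^ 2 →
      (N * (R * (T * M + 1)) : ℝ) ≤
        3 * 10 ^ 12 * (κ * √u) * logFactor κ L D Δ ε ^ 3 ∧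
      (ε ≤ L * D' ^ 2 → (N * (R * (T * (M * (28 * μ * T * √κ * D' ^ 2 / e + 10)) +
        (18432 * κ * N + 10))) : ℝ) ≤
        3 * 10 ^ 12 * (κ ^ 2 * L ^ 2 * D ^ 2 * D' ^ 2 / ε ^ 2) * logFactor κ L D Δ ε ^ 3) := by
    intro hεP
    have hκu : 1 ≤ κ * u := by
      rw [hu, mul_div_assoc', le_div_iff₀ hε]; linarith
    set q := √(κ * u) with hq
    have hq1 : 1 ≤ q := Real.one_le_sqrt.2 hκu
    have hqu : q ^ 2 = κ * u := Real.sq_sqrt (by positivity)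
    have hNq : (N : ℝ) ≤ 5 * q := by
      have h1 : (N : ℝ) < √(12 * (κ * u)) + 1 := Nat.ceil_lt_add_one (Real.sqrt_nonneg _)
      have h2 : √(12 * (κ * u)) ≤ 4 * q := by
        apply Real.sqrt_le_iff.2 ⟨by positivity, ?_⟩
        rw [mul_pow, hqu]; linarith
      linarith
    have hMκ : (M : ℝ) ≤ 6 * √κ := by
      have h1 : (M : ℝ) < √(24 * L / μ) + 1 := Nat.ceil_lt_add_one (Real.sqrt_nonneg _)
      have h2 : √(24 * L / μ) ≤ 5 * √κ := by
        apply Real.sqrt_le_iff.2 ⟨by positivity, ?_⟩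
        rw [mul_pow, Real.sq_sqrt hκ0.le, mul_div_assoc]; linarith
      linarith [Real.one_le_sqrt.2 hκ]
    have hΛ : 2 / 3 ≤ logFactor κ L D Δ ε := by
      have h1 := Real.log_two_gt_d9
      have h2 : Real.log 2 ≤ logFactor κ L D Δ ε := by
        apply Real.log_le_log (by norm_num)
        have : 0 < L * D ^ 2 / ε := hu0
        have : 0 < Δ / ε := by positivity
        linarith
      linarith
    obtain ⟨hTΛ, hRΛ⟩ := log_iterations_le (d := Δ / ε) hκ hu0 (by positivity) hq1 hqu hN' hNq rfl
      (x := 7 * √κ * Δ / e) (by rw [he, hu]; field_simp) rfl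
    -- The constant is 28 · 384 · 125: CGS cost, definition of e, and N³ ≤ 125q³.
    set v := 28 * 48000 * (μ * √κ * D' ^ 2 / (L * D ^ 2)) with hv
    have hw : √κ * v * q ^ 2 = 28 * 48000 * (κ * (L * D' ^ 2 / ε)) := by
      have h1 : √κ * √κ = κ := Real.mul_self_sqrt hκ0.le
      calc √κ * v * q ^ 2
          = 28 * 48000 * (√κ * √κ * (μ * D' ^ 2 / (L * D ^ 2)) * (κ * u)) := by
            rw [hqu, hv]; ring
        _ = _ := by rw [h1, hu, hκdef]; field_simp
    obtain ⟨c1, c2⟩ := oracle_calls_le (T := T) (M := M) (R := R) hκ hq1 (Nat.cast_nonneg _)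
      (Nat.cast_nonneg _) (Nat.cast_nonneg _) hN'.le hNq hTΛ hRΛ hMκ hΛ
      (by positivity : 0 ≤ v) hw.le
    constructor
    · refine c1.trans (le_of_eq ?_)
      have : √κ * q = κ * √u := by
        rw [hq, Real.sqrt_mul hκ0.le, ← mul_assoc, Real.mul_self_sqrt hκ0.le]
      rw [this]; rfl
    · intro hεY
      have h1 : 28 * μ * T * √κ * D' ^ 2 / e ≤ T * v * q ^ 3 := by
        have h2 : (N : ℝ) ^ 3 ≤ 125 * q ^ 3 := by
          calc (N : ℝ) ^ 3 ≤ (5 * q) ^ 3 := pow_le_pow_left₀ hN'.le hNq 3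
            _ = _ := by ring
        calc 28 * μ * T * √κ * D' ^ 2 / e
            = 28 * 384 * T * (μ * √κ * D' ^ 2 / (L * D ^ 2)) * (N : ℝ) ^ 3 := by
              rw [he]; field_simp
          _ ≤ 28 * 384 * T * (μ * √κ * D' ^ 2 / (L * D ^ 2)) * (125 * q ^ 3) := by gcongr
          _ = _ := by rw [hv]; ring
      have h2 : κ ≤ κ * (L * D' ^ 2 / ε) :=
        le_mul_of_one_le_right hκ0.le (by rwa [one_le_div hε])
      have h3 : q ^ 2 * (κ * (L * D' ^ 2 / ε)) =
          κ ^ 2 * L ^ 2 * D ^ 2 * D' ^ 2 / ε ^ 2 := by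
        rw [hqu, hu]; field_simp
      rw [← h3]
      refine le_trans ?_ (c2 h2)
      gcongr
  refine ⟨o, ho, hf.isSaddlePoint hox hoy fun x hx y hy => (hgap x hx y hy).trans ?_,
    fun h => hfo.trans (hcalls h).1, fun h h' => hlo.trans ((hcalls h).2 h')⟩
  rw [div_le_iff₀ (by positivity)]
  have h1 : ε * (12 * (κ * u)) = 12 * (κ * L) * D ^ 2 := by rw [hu]; field_simp
  have h2 := mul_le_mul_of_nonneg_left hNsq hε.le
  linarith

end Complexity

theorem corollary1 :
    ∃ (C : ℝ) (p : ℕ) (outer : ℝ → ℝ → ℝ → ℝ → ℕ) (inner : ℝ → ℝ → ℝ → ℕ), 0 < C ∧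
      ∀ (m n : ℕ) (f : EuclideanSpace ℝ (Fin m) → EuclideanSpace ℝ (Fin n) → ℝ)
        (X : Set (EuclideanSpace ℝ (Fin m))) (Y : Set (EuclideanSpace ℝ (Fin n)))
        (L μ Δ : ℝ)
        (δ₀ : EuclideanSpace ℝ (Fin m) → EuclideanSpace ℝ (Fin n) → ℝ)
        (loX : EuclideanSpace ℝ (Fin m) → EuclideanSpace ℝ (Fin m))
        (loY : EuclideanSpace ℝ (Fin n) → EuclideanSpace ℝ (Fin n))
        (x₀ : EuclideanSpace ℝ (Fin m)) (y₀ : EuclideanSpace ℝ (Fin n)),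
        IsConvexStronglyConcave f X Y L μ → X.Nontrivial → Y.Nontrivial →
        IsLinOracle X loX → IsLinOracle Y loY → x₀ ∈ X → y₀ ∈ Y →
        (∀ x ∈ X, ∀ y ∈ Y, 0 < δ₀ x y ∧ δ₀ x y ≤ Δ ∧ ∀ y' ∈ Y, f x y' - f x y ≤ δ₀ x y) →
        ∀ ε : ℝ, 0 < ε →
          ∃ out : Counted (EuclideanSpace ℝ (Fin m) × EuclideanSpace ℝ (Fin n)),
            mpcgs loX loY X Y f L μ δ₀ inner gammaParam (alphaParam (L / μ) L)
                (zetaParam L (Metric.diam X)) (epsParam (L / μ) L (Metric.diam X))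
                (outer (L / μ) L (Metric.diam X) ε) x₀ y₀ = some out ∧
            IsSaddlePoint f X Y ε out.val.1 out.val.2 ∧
            (ε ≤ L / μ * L * Metric.diam X ^ 2 →
              (out.fo : ℝ) ≤ C * (L / μ * √(L * Metric.diam X ^ 2 / ε)) *
                logFactor (L / μ) L (Metric.diam X) Δ ε ^ p) ∧
            (ε ≤ L / μ * L * Metric.diam X ^ 2 → ε ≤ L * Metric.diam Y ^ 2 →
              (out.lo : ℝ) ≤
                C * ((L / μ) ^ 2 * L ^ 2 * Metric.diam X ^ 2 * Metric.diam Y ^ 2 / ε ^ 2) *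
                logFactor (L / μ) L (Metric.diam X) Δ ε ^ p) := by
  refine ⟨3 * 10 ^ 12, 3, mpIterations, outerIterations, by norm_num, ?_⟩
  intro m n f X Y L μ Δ δ₀ loX loY x₀ y₀ hf hX hY hloX hloY hx₀ hy₀ hδ₀ ε hε
  exact mpcgs_complexity hf hX hY hloX hloY hx₀ hy₀ hδ₀ hε
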